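/- **Setting.** Let $p\in\mathbb N$ and let $u=u_{x,y}=((u_{x,y})_{k,l})$ be a $p\times p$ matrix of complex distributions on $\mathbb R^2$ (generalized kernels). Let $\operatorname{supp}u$ be the union of the supports of the entries, and assume that $r_x:=\sup\{|x|:(x,y)\in\operatorname{supp}u\}$ and $r_y:=\sup\{|y|:(x,y)\in\operatorname{supp}u\}$ are finite. (Thus the entries have compact support, and can be paired with every function that is smooth in a neighbourhood of the support.) For $p\times p$ matrix functions $P(x),Q(y)$ put $\big(\langle P(x),Q(y)\rangle_u\big)_{i,j}:=\sum_{k,l=1}^p\big\langle (u_{x,y})_{k,l},P_{i,k}(x)\,Q_{j,l}(y)\big\rangle$. **Flows.** For $t=(t_1,t_2)$, where $t_i=(t_{i,1},t_{i,2},\dots)$ are sequences of complex numbers, put $t_i(x):=\sum_{j\ge1}t_{i,j}x^j$, let $u^t:=e^{t_1(x)-t_2(y)}u$, that is $\langle P(x),Q(y)\rangle_{u^t}=\langle e^{t_1(x)}P(x),e^{-t_2(y)}Q(y)\rangle_u$, and let $G^t=(G^t_{k,l})_{k,l\ge0}$, $G^t_{k,l}:=\langle I_px^k,I_py^l\rangle_{u^t}$,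 be the Gram matrix. Say that $u^t$ is quasidefinite if all the truncations $(G^t_{k,l})_{0\le k,l<N}$, $N\ge 0$, have nonzero determinant. Then there is a unique Gauss–Borel factorization $G^t=(S_1^t)^{-1}H^t(S_2^t)^{-\top}$, with $S_1^t,S_2^t$ lower unitriangular block matrices and $H^t=\operatorname{diag}(H_0^t,H_1^t,\dots)$ block diagonal with nonsingular $p\times p$ blocks. Put $P^{[i],t}_n(z):=\sum_{k=0}^n(S_i^t)_{n,k}z^k$, $i=1,2$, and define the second kind functions by $$C^{[1],t}_n(z):=\Big\langle P^{[1],t}_n(x),\frac{I_p}{z-y}\Big\rangle_{u^t}\ (|z|>r_y),\qquad \big(C^{[2],t}_n(z)\big)^\top:=\Big\langle\frac{I_p}{z-x},P^{[2],t}_n(y)\Big\rangle_{u^t}\ (|z|>r_x).$$ **Miwa shifts and $\tau$-ratio matrices.** For $z\ne0$ let $[z]:=\big(\tfrac1z,\tfrac1{2z^2},\tfrac1{3z^3},\dots\big)$, $[z]_1:=([z],0)$, $[z]_2:=(0,[z])$. For times $t,s$ at which $u^t$ and $u^s$ are quasidefinite, and $n\ge0$, let $$\tau^{(1)}_n(t,s):=\big(H^t_n(H^s_n)^{-1}\big)\big(H^t_{n-1}(H^s_{n-1})^{-1}\big)\cdots\big(H^t_0(H^s_0)^{-1}\big),\qquad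 \tau^{(2)}_n(t,s):=\big((H^t_n)^{-1}H^s_n\big)\cdots\big((H^t_0)^{-1}H^s_0\big),$$ and $\tau^{(1)}_{-1}=\tau^{(2)}_{-1}:=I_p$. **Theorem (Sato formulas).** Let $t=(t_1,t_2)$ have only finitely many nonzero entries, let $u^t$ be quasidefinite, and let $n\in\{0,1,2,\dots\}$, $z\in\mathbb C$. In each of the following formulas assume moreover that the kernel at the Miwa-shifted times that occur in it is quasidefinite. Then, for $|z|>r_x$, $$P^{[1],t}_n(z)=z^{n}\,\tau^{(1)}_{n-1}(t-[z]_1,t),\qquad \big(C^{[2],t}_n(z)\big)^\top(H^t_n)^{-1}=z^{-n-1}\big(\tau^{(1)}_n(t,t+[z]_1)\big)^{-1},$$ and, for $|z|>r_y$, $$(H^t_n)^{-1}C^{[1],t}_n(z)=z^{-n-1}\,\tau^{(2)}_n(t,t-[z]_2),\qquad \big(P^{[2],t}_n(z)\big)^\top=z^{n}\big(\tau^{(2)}_{n-1}(t+[z]_2,t)\big)^{-1}.$$ -/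

import Mathlib

open scoped Matrix Topology Distributions ENNReal

noncomputable section

namespace SatoToda

/-! ### Generalized kernels and sesquilinear forms -/

/-- A `p × p` matrix of generalized kernels: each entry is a complex-valued distribution
in the two real variables `(x, y)`. -/
abbrev KernelMatrix (p : ℕ) : Type :=
  Matrix (Fin p) (Fin p) 𝓓'((⊤ : TopologicalSpace.Opens (ℝ × ℝ)), ℂ)

/-- The support of a matrix of generalized kernels is the union of the supports of its entries. -/
def kernelSupport {p : ℕ} (u : KernelMatrix p) : Set (ℝ × ℝ) :=
  ⋃ (i : Fin p) (j : Fin p), Distribution.dsupport (u i j)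

/-- `r_x`, the supremum of `|x|` over the projection of the support on the `x`-axis. -/
def radiusX {p : ℕ} (u : KernelMatrix p) : ℝ≥0∞ :=
  ⨆ x ∈ Prod.fst '' kernelSupport u, ‖x‖ₑ

/-- `r_y`, the supremum of `|y|` over the projection of the support on the `y`-axis. -/
def radiusY {p : ℕ} (u : KernelMatrix p) : ℝ≥0∞ :=
  ⨆ y ∈ Prod.snd '' kernelSupport u, ‖y‖ₑ

open Classical in
/-- The pairing `⟨w, φ⟩` of a distribution `w` of compact support with a complex function `φ`
which is smooth in a neighbourhood of the support of `w`: it is the value of `w` on any test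
function `a + i b` (with `a`, `b` real test functions) which agrees with `φ` in a neighbourhood
of the support. The value does not depend on the choice of the test function, since `w` vanishes
on all test functions supported in the complement of its support. (Distributions are real-linear
maps on real test functions, hence the decomposition in real and imaginary parts.) -/
def pairing (w : 𝓓'((⊤ : TopologicalSpace.Opens (ℝ × ℝ)), ℂ)) (φ : ℝ × ℝ → ℂ) : ℂ :=
  if h : ∃ g : 𝓓((⊤ : TopologicalSpace.Opens (ℝ × ℝ)), ℝ) ×
        𝓓((⊤ : TopologicalSpace.Opens (ℝ × ℝ)), ℝ),
      ∀ᶠ q in 𝓝ˢ (Distribution.dsupport w), φ q = (g.1 q : ℂ) + Complex.I * (g.2 q : ℂ)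
  then w h.choose.1 + Complex.I * w h.choose.2
  else 0

/-- The sesquilinear form `⟨P(x), Q(y)⟩_u`, whose `(i, j)` entry is
`∑_{k,l} ⟨u_{k,l}, P_{i,k}(x) ⊗ Q_{j,l}(y)⟩`. -/
def sesqForm {p : ℕ} (u : KernelMatrix p) (P Q : ℝ → Matrix (Fin p) (Fin p) ℂ) :
    Matrix (Fin p) (Fin p) ℂ :=
  Matrix.of fun i j => ∑ k, ∑ l, pairing (u k l) fun q => P q.1 i k * Q q.2 j l

/-! ### Times, flows and Miwa shifts -/

/-- A pair of time sequences `t = (t₁, t₂)`. The entry of index `j` of a sequence is the time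
usually numbered `j + 1`. -/
abbrev Times : Type := (ℕ → ℂ) × (ℕ → ℂ)

/-- The function `s(x) = s₁ x + s₂ x² + s₃ x³ + ⋯` attached to a time sequence. -/
def timeFunction (s : ℕ → ℂ) (x : ℝ) : ℂ := ∑' j : ℕ, s j * (x : ℂ) ^ (j + 1)

/-- The coherent shift `[z] = (1/z, 1/(2 z²), 1/(3 z³), …)`. -/
def miwa (z : ℂ) : ℕ → ℂ := fun j => 1 / (((j : ℂ) + 1) * z ^ (j + 1))

/-- `[z]₁`: the coherent shift, acting on the first family of times only. -/
def miwaX (z : ℂ) : Times := (miwa z, 0)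

/-- `[z]₂`: the coherent shift, acting on the second family of times only. -/
def miwaY (z : ℂ) : Times := (0, miwa z)

/-- The sesquilinear form of the deformed kernel `u^t = exp(t₁(x) - t₂(y)) u`. -/
def flowForm {p : ℕ} (u : KernelMatrix p) (t : Times) (P Q : ℝ → Matrix (Fin p) (Fin p) ℂ) :
    Matrix (Fin p) (Fin p) ℂ :=
  sesqForm u (fun x => Complex.exp (timeFunction t.1 x) • P x)
    (fun y => Complex.exp (-timeFunction t.2 y) • Q y)

/-! ### Gram matrices and the Gauss--Borel factorization -/

/-- Semi-infinite matrices with blocks in `ℂ^{p × p}`. -/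
abbrev BlockMatrix (p : ℕ) : Type := ℕ → ℕ → Matrix (Fin p) (Fin p) ℂ

/-- The Gram matrix `G^t`, with blocks `⟨x^k I, y^l I⟩_{u^t}`. -/
def gram {p : ℕ} (u : KernelMatrix p) (t : Times) : BlockMatrix p := fun k l =>
  flowForm u t (fun x => (x : ℂ) ^ k • 1) (fun y => (y : ℂ) ^ l • 1)

/-- The truncation `G_{[k]}` to the first `k` rows and columns of blocks. -/
def truncation {p : ℕ} (G : BlockMatrix p) (k : ℕ) : Matrix (Fin k × Fin p) (Fin k × Fin p) ℂ :=
  Matrix.of fun a b => G a.1 b.1 a.2 b.2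

/-- Quasidefiniteness: all the block principal minors `det G_{[k]}` are nonzero. -/
def Quasidefinite {p : ℕ} (G : BlockMatrix p) : Prop :=
  ∀ k : ℕ, (truncation G k).det ≠ 0

/-- Lower unitriangular block matrices. -/
def LowerUnitriangular {p : ℕ} (S : BlockMatrix p) : Prop :=
  (∀ n, S n n = 1) ∧ ∀ n m, n < m → S n m = 0

/-- `T` is the inverse of `S`, for lower unitriangular semi-infinite block matrices (the sum is
the whole row-by-column product, since `S n k = 0` for `n < k`). -/
def IsInverse {p : ℕ} (S T : BlockMatrix p) : Prop :=
  ∀ n m, ∑ k ∈ Finset.range (n + 1), S n k * T k m = if n = m then 1 else 0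

/-- The Gauss--Borel factorization `G = S₁⁻¹ H S₂^{-⊤}`, with `S₁`, `S₂` lower unitriangular
and `H = diag(H₀, H₁, …)`; here `T₁ = S₁⁻¹` and `T₂ = S₂⁻¹`. -/
def IsGaussBorel {p : ℕ} (G S₁ : BlockMatrix p) (H : ℕ → Matrix (Fin p) (Fin p) ℂ)
    (S₂ : BlockMatrix p) : Prop :=
  LowerUnitriangular S₁ ∧ LowerUnitriangular S₂ ∧
    ∃ T₁ T₂ : BlockMatrix p, LowerUnitriangular T₁ ∧ LowerUnitriangular T₂ ∧
      IsInverse S₁ T₁ ∧ IsInverse S₂ T₂ ∧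
      ∀ k l, G k l = ∑ m ∈ Finset.range (k + 1), T₁ k m * H m * (T₂ l m)ᵀ

open Classical in
/-- The triple `(S₁, H, S₂)` of the Gauss--Borel factorization of `G`; it exists and is unique
when `G` is quasidefinite. -/
def gaussBorel {p : ℕ} (G : BlockMatrix p) :
    BlockMatrix p × (ℕ → Matrix (Fin p) (Fin p) ℂ) × BlockMatrix p :=
  if h : ∃ F : BlockMatrix p × (ℕ → Matrix (Fin p) (Fin p) ℂ) × BlockMatrix p,
      IsGaussBorel G F.1 F.2.1 F.2.2
  then h.choose
  else 0

/-- The matrices `S₁^t`. -/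
def gbS₁ {p : ℕ} (u : KernelMatrix p) (t : Times) : BlockMatrix p := (gaussBorel (gram u t)).1

/-- The quasitau matrices `H^t_n`. -/
def quasiTau {p : ℕ} (u : KernelMatrix p) (t : Times) : ℕ → Matrix (Fin p) (Fin p) ℂ :=
  (gaussBorel (gram u t)).2.1

/-- The matrices `S₂^t`. -/
def gbS₂ {p : ℕ} (u : KernelMatrix p) (t : Times) : BlockMatrix p := (gaussBorel (gram u t)).2.2

/-! ### Biorthogonal polynomials and second kind functions -/

/-- The biorthogonal polynomials `P^{[1],t}_n`, from `P^{[1],t} = S₁^t χ`. -/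
def polyOne {p : ℕ} (u : KernelMatrix p) (t : Times) (n : ℕ) (z : ℂ) :
    Matrix (Fin p) (Fin p) ℂ :=
  ∑ k ∈ Finset.range (n + 1), z ^ k • gbS₁ u t n k

/-- The biorthogonal polynomials `P^{[2],t}_n`, from `P^{[2],t} = S₂^t χ`. -/
def polyTwo {p : ℕ} (u : KernelMatrix p) (t : Times) (n : ℕ) (z : ℂ) :
    Matrix (Fin p) (Fin p) ℂ :=
  ∑ k ∈ Finset.range (n + 1), z ^ k • gbS₂ u t n k

/-- The second kind functions `C^{[1],t}_n(z) = ⟨P^{[1],t}_n(x), I/(z - y)⟩_{u^t}`. -/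
def secondKindOne {p : ℕ} (u : KernelMatrix p) (t : Times) (n : ℕ) (z : ℂ) :
    Matrix (Fin p) (Fin p) ℂ :=
  flowForm u t (fun x => polyOne u t n (x : ℂ)) (fun y => (z - (y : ℂ))⁻¹ • 1)

/-- The second kind functions `C^{[2],t}_n(z)`, given by
`(C^{[2],t}_n(z))^⊤ = ⟨I/(z - x), P^{[2],t}_n(y)⟩_{u^t}`. -/
def secondKindTwo {p : ℕ} (u : KernelMatrix p) (t : Times) (n : ℕ) (z : ℂ) :
    Matrix (Fin p) (Fin p) ℂ :=
  (flowForm u t (fun x => (z - (x : ℂ))⁻¹ • 1) (fun y => polyTwo u t n (y : ℂ)))ᵀ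

/-! ### `τ`-ratio matrices -/

/-- The ordered product `A_{N-1} A_{N-2} ⋯ A_0` of the first `N` terms of a sequence. -/
def leftProd {p : ℕ} (A : ℕ → Matrix (Fin p) (Fin p) ℂ) : ℕ → Matrix (Fin p) (Fin p) ℂ
  | 0 => 1
  | N + 1 => A N * leftProd A N

/-- `τ^{(1)}_n(t, s)`, the ordered product of `H^t_m (H^s_m)⁻¹` with `m` running from `n` (leftmost)
down to `0` (rightmost). The index is an integer in order to allow the empty product
`τ^{(1)}_{-1} = I`. -/
def tauOne {p : ℕ} (u : KernelMatrix p) (n : ℤ) (t s : Times) : Matrix (Fin p) (Fin p) ℂ :=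
  leftProd (fun m => quasiTau u t m * (quasiTau u s m)⁻¹) (n + 1).toNat

/-- `τ^{(2)}_n(t, s)`, the ordered product of `(H^t_m)⁻¹ H^s_m` with `m` running from `n` (leftmost)
down to `0` (rightmost). The index is an integer in order to allow the empty product
`τ^{(2)}_{-1} = I`. -/
def tauTwo {p : ℕ} (u : KernelMatrix p) (n : ℤ) (t s : Times) : Matrix (Fin p) (Fin p) ℂ :=
  leftProd (fun m => (quasiTau u t m)⁻¹ * quasiTau u s m) (n + 1).toNat

end SatoToda

end

/-! Write P_n for P^{[1]}_n, and let primes refer to a transformed kernel u'. For |x| < |z| one has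
exp(-∑_{j≥1} (x/z)^j / j) = 1 - x/z, so a Miwa shift multiplies or divides the kernel by a linear
factor. On Gram matrices this is a Darboux transformation: one of G, G' is the other minus z⁻¹ times
its own shift by one block row or column.

If u' = (1 - x/z)u, then (x - z)P'_n = P_{n+1} - z H'_n H_n⁻¹ P_n, because the difference of the two
sides has degree at most n and is orthogonal to 1, y, …, y^n, hence vanishes by quasidefiniteness.
At x = z this gives P_{n+1}(z) = z H'_n H_n⁻¹ P_n(z) (`IsGaussBorel.eval_succ`), and iterating from
P_0 = I produces the τ-ratio.

For second kind functions the Cauchy kernel is itself a Miwa factor: 1/(z - y) = z⁻¹(1 - y/z)⁻¹, so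
C^{[1]}_n(z) = z⁻¹⟨P_n, I⟩_{u'} with u' = (1 - y/z)⁻¹u. The same degree argument gives P'_{n+1} =
P_{n+1} - z⁻¹ H'_{n+1} H_n⁻¹ P_n, and pairing with I under u' kills the left side
(`IsGaussBorel.first_succ`). Transposing the Gram matrix exchanges the two families
(`IsGaussBorel.transpose`) and yields the other two formulas. -/

noncomputable section
namespace SatoToda
open scoped ContDiff Manifold

/-! ### Pairing distributions with functions smooth near the support. -/

/-- A distribution vanishes on the complement of its support. -/
theorem isVanishingOn_compl_dsupport (w : 𝓓'((⊤ : TopologicalSpace.Opens (ℝ × ℝ)), ℂ)) :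
    Distribution.IsVanishingOn w (Distribution.dsupport w)ᶜ := by
  intro f hf
  have hK : IsCompact (tsupport f) := f.hasCompactSupport
  have hx : ∀ x : tsupport f, ∃ s : Set (ℝ × ℝ),
      Distribution.IsVanishingOn w s ∧ IsOpen s ∧ (x : ℝ × ℝ) ∈ s := fun x =>
    (Distribution.notMem_dsupport_iff (f := w) (x : ℝ × ℝ)).1 (hf x.2)
  choose U hUv hUo hUx using hx
  -- Vanishing is only known locally; a partition of unity on the support of `f` globalizes it, and
  -- compactness leaves finitely many nonzero pieces.
  obtain ⟨ρ, hρ⟩ := SmoothPartitionOfUnity.exists_isSubordinate 𝓘(ℝ, ℝ × ℝ)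
    (isClosed_tsupport f) U hUo fun x hx => Set.mem_iUnion.2 ⟨⟨x, hx⟩, hUx ⟨x, hx⟩⟩
  have hfin := ρ.locallyFinite.finite_nonempty_inter_compact hK
  have hsm : ∀ i, ContDiff ℝ ∞ (ρ i) := fun i => (ρ i).contMDiff.contDiff
  let g : tsupport f → 𝓓((⊤ : TopologicalSpace.Opens (ℝ × ℝ)), ℝ) := fun i =>
    ⟨fun q => ρ i q * f q, (hsm i).mul f.contDiff, f.hasCompactSupport.mul_left,
      fun _ _ => trivial⟩
  have hg : ∀ i, w (g i) = 0 := fun i =>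
    hUv i (g i) ((closure_mono (Function.support_mul_subset_left _ _)).trans (hρ i))
  have hsum : f = ∑ i ∈ hfin.toFinset, g i := by
    ext q
    have h1 : (∑ i ∈ hfin.toFinset, g i) q = ∑ i ∈ hfin.toFinset, ρ i q * f q := by
      have : ∀ s : Finset (tsupport f), (∑ i ∈ s, g i) q = ∑ i ∈ s, ρ i q * f q := by
        intro s
        induction s using Finset.cons_induction with
        | empty => rfl
        | cons a s ha ih => rw [Finset.sum_cons, Finset.sum_cons, ← ih]; rfl
      exact this _
    rw [h1, ← Finset.sum_mul]
    by_cases hq : q ∈ tsupport f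
    · have h2 := ρ.sum_eq_one hq
      rw [finsum_eq_sum_of_support_subset (s := hfin.toFinset)] at h2
      · rw [h2, one_mul]
      · intro i hi
        simp only [Set.Finite.coe_toFinset, Set.mem_ofPred_eq]
        exact ⟨q, hi, hq⟩
    · rw [image_eq_zero_of_notMem_tsupport hq, mul_zero]
  rw [hsum, map_sum]
  exact Finset.sum_eq_zero fun i _ => hg i

/-- A distribution takes the same value on test functions which agree near its support. -/
theorem apply_eq_of_eventuallyEq (w : 𝓓'((⊤ : TopologicalSpace.Opens (ℝ × ℝ)), ℂ))
    {f g : 𝓓((⊤ : TopologicalSpace.Opens (ℝ × ℝ)), ℝ)}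
    (h : ∀ᶠ q in 𝓝ˢ (Distribution.dsupport w), f q = g q) : w f = w g := by
  rw [← sub_eq_zero, ← map_sub]
  refine isVanishingOn_compl_dsupport w _ fun q hq hqs => ?_
  have h1 : ∀ᶠ y in 𝓝 q, f y = g y := h.filter_mono (nhds_le_nhdsSet hqs)
  exact notMem_tsupport_iff_eventuallyEq.2 (h1.mono fun y hy => sub_eq_zero.2 hy) hq

/-- `φ` agrees near the support of `w` with the complex test function `a + i b`. -/
def Represents (w : 𝓓'((⊤ : TopologicalSpace.Opens (ℝ × ℝ)), ℂ)) (φ : ℝ × ℝ → ℂ)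
    (a b : 𝓓((⊤ : TopologicalSpace.Opens (ℝ × ℝ)), ℝ)) : Prop :=
  ∀ᶠ q in 𝓝ˢ (Distribution.dsupport w), φ q = (a q : ℂ) + Complex.I * (b q : ℂ)

/-- `φ` agrees near the support of `w` with some complex test function. -/
def Pairable (w : 𝓓'((⊤ : TopologicalSpace.Opens (ℝ × ℝ)), ℂ)) (φ : ℝ × ℝ → ℂ) : Prop :=
  ∃ a b, Represents w φ a b

variable {w : 𝓓'((⊤ : TopologicalSpace.Opens (ℝ × ℝ)), ℂ)} {φ ψ : ℝ × ℝ → ℂ}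

/-- The representative chosen in `pairing` and `(a, b)` agree near the support, in real and
imaginary parts separately, so `w` does not distinguish them. Linearity of `pairing` reduces to
this. -/
theorem Represents.pairing_eq {a b : 𝓓((⊤ : TopologicalSpace.Opens (ℝ × ℝ)), ℝ)}
    (h : Represents w φ a b) : pairing w φ = w a + Complex.I * w b := by
  have hex : ∃ g : 𝓓((⊤ : TopologicalSpace.Opens (ℝ × ℝ)), ℝ) ×
        𝓓((⊤ : TopologicalSpace.Opens (ℝ × ℝ)), ℝ),
      ∀ᶠ q in 𝓝ˢ (Distribution.dsupport w), φ q = (g.1 q : ℂ) + Complex.I * (g.2 q : ℂ) :=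
    ⟨(a, b), h⟩
  have hc := h.and hex.choose_spec
  rw [pairing, dif_pos hex]
  congr 1
  · refine apply_eq_of_eventuallyEq w (hc.mono fun q hq => ?_)
    simpa using (congrArg Complex.re (hq.2.symm.trans hq.1))
  · congr 1
    refine apply_eq_of_eventuallyEq w (hc.mono fun q hq => ?_)
    simpa using (congrArg Complex.im (hq.2.symm.trans hq.1))

theorem Represents.add {a b c d : 𝓓((⊤ : TopologicalSpace.Opens (ℝ × ℝ)), ℝ)}
    (h : Represents w φ a b) (h' : Represents w ψ c d) :
    Represents w (fun q => φ q + ψ q) (a + c) (b + d) := by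
  filter_upwards [h, h'] with q hq hq'
  rw [hq, hq', FunLike.coe_add, FunLike.coe_add]
  simp only [Pi.add_apply]
  push_cast
  ring

theorem Represents.const_mul {a b : 𝓓((⊤ : TopologicalSpace.Opens (ℝ × ℝ)), ℝ)}
    (h : Represents w φ a b) (c : ℂ) :
    Represents w (fun q => c * φ q) (c.re • a - c.im • b) (c.re • b + c.im • a) := by
  filter_upwards [h] with q hq
  rw [hq, FunLike.coe_add, FunLike.coe_sub]
  simp only [Pi.add_apply, Pi.sub_apply, FunLike.coe_smul, Pi.smul_apply, smul_eq_mul]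
  apply Complex.ext <;> simp

theorem represents_zero : Represents w (fun _ => 0) 0 0 :=
  Filter.Eventually.of_forall fun q => by simp

theorem Pairable.add (h : Pairable w φ) (h' : Pairable w ψ) :
    Pairable w (fun q => φ q + ψ q) := by
  obtain ⟨a, b, h⟩ := h
  obtain ⟨c, d, h'⟩ := h'
  exact ⟨_, _, h.add h'⟩

theorem Pairable.const_mul (h : Pairable w φ) (c : ℂ) : Pairable w (fun q => c * φ q) := by
  obtain ⟨a, b, h⟩ := h
  exact ⟨_, _, h.const_mul c⟩

theorem Pairable.congr (h : Pairable w φ)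
    (hψ : ∀ᶠ q in 𝓝ˢ (Distribution.dsupport w), φ q = ψ q) : Pairable w ψ := by
  obtain ⟨a, b, h⟩ := h
  exact ⟨a, b, by filter_upwards [h, hψ] with q h1 h2; rw [← h2, h1]⟩

theorem pairable_zero : Pairable w fun _ => 0 := ⟨_, _, represents_zero⟩

theorem Pairable.sum {ι : Type*} {s : Finset ι} {f : ι → ℝ × ℝ → ℂ}
    (h : ∀ i ∈ s, Pairable w (f i)) : Pairable w fun q => ∑ i ∈ s, f i q := by
  induction s using Finset.cons_induction with
  | empty => simpa using pairable_zero
  | cons a s ha ih =>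
    simp only [Finset.sum_cons]
    exact (h a (by simp)).add (ih fun i hi => h i (by simp [hi]))

theorem pairing_congr (h : ∀ᶠ q in 𝓝ˢ (Distribution.dsupport w), φ q = ψ q)
    (hφ : Pairable w φ) : pairing w φ = pairing w ψ := by
  obtain ⟨a, b, ha⟩ := hφ
  have hb : Represents w ψ a b := by filter_upwards [h, ha] with q h1 h2; rw [← h1, h2]
  rw [ha.pairing_eq, hb.pairing_eq]

theorem pairing_zero : pairing w (fun _ => 0) = 0 := by
  rw [represents_zero.pairing_eq]; simp

theorem pairing_add (h : Pairable w φ) (h' : Pairable w ψ) :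
    pairing w (fun q => φ q + ψ q) = pairing w φ + pairing w ψ := by
  obtain ⟨a, b, h⟩ := h
  obtain ⟨c, d, h'⟩ := h'
  rw [h.pairing_eq, h'.pairing_eq, (h.add h').pairing_eq, map_add, map_add]
  ring

theorem pairing_const_mul (h : Pairable w φ) (c : ℂ) :
    pairing w (fun q => c * φ q) = c * pairing w φ := by
  obtain ⟨a, b, h⟩ := h
  rw [h.pairing_eq, (h.const_mul c).pairing_eq, map_add, map_sub, map_smul, map_smul, map_smul,
    map_smul]
  simp only [Complex.real_smul]
  conv_rhs => rw [← Complex.re_add_im c]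
  linear_combination (c.im * w b : ℂ) * (- Complex.I_mul_I)

theorem pairing_sum {ι : Type*} {s : Finset ι} {f : ι → ℝ × ℝ → ℂ}
    (h : ∀ i ∈ s, Pairable w (f i)) :
    pairing w (fun q => ∑ i ∈ s, f i q) = ∑ i ∈ s, pairing w (f i) := by
  induction s using Finset.cons_induction with
  | empty => simpa using pairing_zero
  | cons a s ha ih =>
    simp only [Finset.sum_cons]
    have hs : ∀ i ∈ s, Pairable w (f i) := fun i hi => h i (by simp [hi])
    rw [pairing_add (h a (by simp)) (Pairable.sum hs), ih hs]

/-- Functions smooth in a neighbourhood of a compact support can be paired. -/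
theorem pairable_of_contDiffOn (hw : IsCompact (Distribution.dsupport w)) {V : Set (ℝ × ℝ)}
    (hV : IsOpen V) (hwV : Distribution.dsupport w ⊆ V) (hφ : ContDiffOn ℝ ∞ φ V) :
    Pairable w φ := by
  -- A cutoff equal to 1 near the support and supported in the compact set `L ⊆ V` turns the real
  -- and imaginary parts of `φ` into test functions; extension by zero is smooth because `φ` is
  -- smooth wherever the cutoff lives.
  obtain ⟨L, hL, hwL, hLV⟩ := exists_compact_between hw hV hwV
  obtain ⟨χ, hχ1, hχ0, -⟩ := exists_contMDiffMap_one_nhds_of_subset_interior 𝓘(ℝ, ℝ × ℝ)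
    (n := ⊤) hw.isClosed hwL
  have hχs : ContDiff ℝ ∞ χ := χ.contMDiff.contDiff
  have hsupp : tsupport χ ⊆ L :=
    closure_minimal (fun x hx => by_contra fun hxL => hx (hχ0 x hxL)) hL.isClosed
  have key : ∀ f : ℝ × ℝ → ℝ, ContDiffOn ℝ ∞ f V →
      ∃ a : 𝓓((⊤ : TopologicalSpace.Opens (ℝ × ℝ)), ℝ), ∀ q, a q = χ q * f q := by
    intro f hf
    have hts : tsupport (fun q => χ q * f q) ⊆ tsupport χ :=
      closure_mono (Function.support_mul_subset_left _ _)
    refine ⟨⟨fun q => χ q * f q, contMDiff_iff_contDiff.1 <| contMDiff_of_tsupport fun x hx => ?_,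
      hL.of_isClosed_subset (isClosed_tsupport _) (hts.trans hsupp), fun _ _ => trivial⟩,
      fun q => rfl⟩
    exact (hχs.contDiffAt.mul
      (hf.contDiffAt (hV.mem_nhds (hLV (hsupp (hts hx)))))).contMDiffAt
  obtain ⟨a, ha⟩ := key (fun q => (φ q).re) (Complex.reCLM.contDiff.comp_contDiffOn hφ)
  obtain ⟨b, hb⟩ := key (fun q => (φ q).im) (Complex.imCLM.contDiff.comp_contDiffOn hφ)
  refine ⟨a, b, hχ1.mono fun q hq => ?_⟩
  rw [ha, hb, hq, one_mul, one_mul, mul_comm, Complex.re_add_im]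

end SatoToda
end

noncomputable section
namespace SatoToda
open scoped ContDiff

/-! ### Functions smooth near a subset of the line -/

/-- `f` is smooth on a neighbourhood of `A`. -/
def SmoothNear (A : Set ℝ) (f : ℝ → ℂ) : Prop := ∃ V, IsOpen V ∧ A ⊆ V ∧ ContDiffOn ℝ ∞ f V

variable {A : Set ℝ} {f g : ℝ → ℂ}

theorem SmoothNear.of_contDiff (h : ContDiff ℝ ∞ f) : SmoothNear A f :=
  ⟨Set.univ, isOpen_univ, Set.subset_univ _, h.contDiffOn⟩

theorem SmoothNear.mul (hf : SmoothNear A f) (hg : SmoothNear A g) :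
    SmoothNear A fun x => f x * g x := by
  obtain ⟨V, hV, hAV, hf⟩ := hf
  obtain ⟨W, hW, hAW, hg⟩ := hg
  exact ⟨V ∩ W, hV.inter hW, Set.subset_inter hAV hAW,
    (hf.mono Set.inter_subset_left).mul (hg.mono Set.inter_subset_right)⟩

/-- Needed for Miwa-shifted weights: their closed form is available only on `interval z`, where the
series of times converges. -/
theorem SmoothNear.congr (hf : SmoothNear A f) {V : Set ℝ} (hV : IsOpen V) (hAV : A ⊆ V)
    (h : ∀ x ∈ V, g x = f x) : SmoothNear A g := by
  obtain ⟨W, hW, hAW, hf⟩ := hf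
  exact ⟨W ∩ V, hW.inter hV, Set.subset_inter hAW hAV,
    (hf.mono Set.inter_subset_left).congr fun x hx => h x hx.2⟩

theorem contDiff_ofReal_pow (k : ℕ) : ContDiff ℝ ∞ fun x : ℝ => (x : ℂ) ^ k :=
  Complex.ofRealCLM.contDiff.pow k

theorem SmoothNear.ofReal_pow (k : ℕ) : SmoothNear A fun x : ℝ => (x : ℂ) ^ k :=
  .of_contDiff (contDiff_ofReal_pow k)

theorem contDiff_timeFunction {s : ℕ → ℂ} (hs : (Function.support s).Finite) :
    ContDiff ℝ ∞ (timeFunction s) := by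
  have h : timeFunction s = fun x : ℝ => ∑ j ∈ hs.toFinset, s j * (x : ℂ) ^ (j + 1) := by
    funext x
    refine tsum_eq_sum fun j hj => ?_
    rw [Set.Finite.mem_toFinset, Function.notMem_support] at hj
    rw [hj, zero_mul]
  rw [h]
  exact ContDiff.sum fun j _ => contDiff_const.mul (contDiff_ofReal_pow _)

theorem SmoothNear.exp_timeFunction {s : ℕ → ℂ} (hs : (Function.support s).Finite) :
    SmoothNear A fun x => Complex.exp (timeFunction s x) :=
  .of_contDiff (Complex.contDiff_exp.comp (contDiff_timeFunction hs))

theorem SmoothNear.exp_neg_timeFunction {s : ℕ → ℂ} (hs : (Function.support s).Finite) :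
    SmoothNear A fun x => Complex.exp (-timeFunction s x) :=
  .of_contDiff (Complex.contDiff_exp.comp (contDiff_timeFunction hs).neg)

/-! ### Miwa shifts -/

/-- The interval `|x| < |z|`. -/
def interval (z : ℂ) : Set ℝ := {x | ‖(x : ℂ)‖ < ‖z‖}

theorem isOpen_interval (z : ℂ) : IsOpen (interval z) :=
  isOpen_lt (by fun_prop) continuous_const

theorem ne_zero_of_mem_interval {z : ℂ} {x : ℝ} (hx : x ∈ interval z) : z ≠ 0 :=
  norm_pos_iff.1 ((norm_nonneg _).trans_lt hx)

theorem sub_ne_zero_of_mem_interval {z : ℂ} {x : ℝ} (hx : x ∈ interval z) : z - x ≠ 0 :=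
  sub_ne_zero.2 fun h => by rw [interval, Set.mem_ofPred_eq, h] at hx; exact lt_irrefl _ hx

theorem one_sub_ne_zero_of_mem_interval {z : ℂ} {x : ℝ} (hx : x ∈ interval z) :
    1 - z⁻¹ * x ≠ 0 := by
  have h := ne_zero_of_mem_interval hx
  have : 1 - z⁻¹ * x = z⁻¹ * (z - x) := by field_simp
  rw [this]
  exact mul_ne_zero (inv_ne_zero h) (sub_ne_zero_of_mem_interval hx)

theorem SmoothNear.inv_sub {z : ℂ} (hA : A ⊆ interval z) :
    SmoothNear A fun x : ℝ => (z - (x : ℂ))⁻¹ :=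
  ⟨interval z, isOpen_interval z, hA,
    (contDiffOn_const.sub Complex.ofRealCLM.contDiff.contDiffOn).inv
      fun _ hx => sub_ne_zero_of_mem_interval hx⟩

/-- This is the Taylor series of -log(1 - w) at w = x/z, and the source of every linear factor
below. -/
theorem hasSum_miwa {z : ℂ} {x : ℝ} (hx : x ∈ interval z) :
    HasSum (fun j => miwa z j * (x : ℂ) ^ (j + 1)) (-Complex.log (1 - z⁻¹ * x)) := by
  have hz := ne_zero_of_mem_interval hx
  have h : ‖z⁻¹ * x‖ < 1 := by
    rw [norm_mul, norm_inv, inv_mul_lt_one₀ (norm_pos_iff.2 hz)]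
    exact hx
  convert Complex.hasSum_taylorSeries_neg_log' h using 2 with j
  have : (j : ℂ) + 1 ≠ 0 := by exact_mod_cast j.succ_ne_zero
  rw [miwa, mul_pow, inv_pow]
  field_simp

theorem summable_timeFunction {s : ℕ → ℂ} (hs : (Function.support s).Finite) (x : ℝ) :
    Summable fun j => s j * (x : ℂ) ^ (j + 1) :=
  summable_of_hasFiniteSupport (hs.subset fun _ hj => left_ne_zero_of_mul hj)

theorem timeFunction_sub_miwa {s : ℕ → ℂ} (hs : (Function.support s).Finite) {z : ℂ} {x : ℝ}
    (hx : x ∈ interval z) :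
    timeFunction (s - miwa z) x = timeFunction s x + Complex.log (1 - z⁻¹ * x) := by
  have h := ((summable_timeFunction hs x).hasSum.sub (hasSum_miwa hx)).tsum_eq
  rw [sub_neg_eq_add] at h
  rw [timeFunction, timeFunction, ← h]
  exact tsum_congr fun j => by rw [Pi.sub_apply, sub_mul]

theorem timeFunction_add_miwa {s : ℕ → ℂ} (hs : (Function.support s).Finite) {z : ℂ} {x : ℝ}
    (hx : x ∈ interval z) :
    timeFunction (s + miwa z) x = timeFunction s x - Complex.log (1 - z⁻¹ * x) := by
  have h := ((summable_timeFunction hs x).hasSum.add (hasSum_miwa hx)).tsum_eq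
  rw [← sub_eq_add_neg] at h
  rw [timeFunction, timeFunction, ← h]
  exact tsum_congr fun j => by rw [Pi.add_apply, add_mul]

theorem exp_timeFunction_sub_miwa {s : ℕ → ℂ} (hs : (Function.support s).Finite) {z : ℂ} {x : ℝ}
    (hx : x ∈ interval z) :
    Complex.exp (timeFunction (s - miwa z) x) =
      Complex.exp (timeFunction s x) * (1 - z⁻¹ * x) := by
  rw [timeFunction_sub_miwa hs hx, Complex.exp_add,
    Complex.exp_log (one_sub_ne_zero_of_mem_interval hx)]

theorem exp_timeFunction_add_miwa {s : ℕ → ℂ} (hs : (Function.support s).Finite) {z : ℂ} {x : ℝ}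
    (hx : x ∈ interval z) :
    Complex.exp (timeFunction (s + miwa z) x) =
      Complex.exp (timeFunction s x) * (z * (z - x)⁻¹) := by
  have h := one_sub_ne_zero_of_mem_interval hx
  have h' := sub_ne_zero_of_mem_interval hx
  have hz := ne_zero_of_mem_interval hx
  rw [timeFunction_add_miwa hs hx, Complex.exp_sub, Complex.exp_log h, div_eq_mul_inv]
  congr 1
  rw [inv_eq_iff_eq_inv, mul_inv, inv_inv]
  field_simp

theorem exp_neg_timeFunction_add_miwa {s : ℕ → ℂ} (hs : (Function.support s).Finite) {z : ℂ}
    {x : ℝ} (hx : x ∈ interval z) :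
    Complex.exp (-timeFunction (s + miwa z) x) =
      Complex.exp (-timeFunction s x) * (1 - z⁻¹ * x) := by
  rw [timeFunction_add_miwa hs hx, neg_sub', sub_neg_eq_add, Complex.exp_add,
    Complex.exp_log (one_sub_ne_zero_of_mem_interval hx)]

theorem exp_neg_timeFunction_sub_miwa {s : ℕ → ℂ} (hs : (Function.support s).Finite) {z : ℂ}
    {x : ℝ} (hx : x ∈ interval z) :
    Complex.exp (-timeFunction (s - miwa z) x) =
      Complex.exp (-timeFunction s x) * (z * (z - x)⁻¹) := by
  rw [Complex.exp_neg, exp_timeFunction_sub_miwa hs hx, Complex.exp_neg, mul_inv]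
  have h' := sub_ne_zero_of_mem_interval hx
  have hz := ne_zero_of_mem_interval hx
  congr 1
  rw [inv_eq_iff_eq_inv, mul_inv, inv_inv]
  field_simp

/-! ### Moments -/

section moments

variable {p : ℕ} (u : KernelMatrix p)

/-- The projection of the support on the `x`-axis. -/
def supportX : Set ℝ := Prod.fst '' kernelSupport u

/-- The projection of the support on the `y`-axis. -/
def supportY : Set ℝ := Prod.snd '' kernelSupport u

/-- The matrix of the pairings `⟨u_{i,j}, f(x) g(y)⟩`. -/
def moment (f g : ℝ → ℂ) : Matrix (Fin p) (Fin p) ℂ :=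
  Matrix.of fun i j => pairing (u i j) fun q => f q.1 * g q.2

variable {u}

theorem dsupport_subset_kernelSupport (i j : Fin p) :
    Distribution.dsupport (u i j) ⊆ kernelSupport u :=
  Set.subset_iUnion₂_of_subset i j subset_rfl

theorem supportX_subset_interval {z : ℂ} (h : radiusX u < ‖z‖ₑ) : supportX u ⊆ interval z := by
  intro x hx
  have h1 : ‖x‖ₑ < ‖z‖ₑ := lt_of_le_of_lt (le_iSup₂ (f := fun x _ => ‖x‖ₑ) x hx) h
  have h2 := (ENNReal.toReal_lt_toReal enorm_ne_top enorm_ne_top).2 h1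
  rw [toReal_enorm, toReal_enorm] at h2
  simpa [interval] using h2

theorem supportY_subset_interval {z : ℂ} (h : radiusY u < ‖z‖ₑ) : supportY u ⊆ interval z := by
  intro x hx
  have h1 : ‖x‖ₑ < ‖z‖ₑ := lt_of_le_of_lt (le_iSup₂ (f := fun x _ => ‖x‖ₑ) x hx) h
  have h2 := (ENNReal.toReal_lt_toReal enorm_ne_top enorm_ne_top).2 h1
  rw [toReal_enorm, toReal_enorm] at h2
  simpa [interval] using h2

theorem isCompact_dsupport (hrx : radiusX u < ⊤) (hry : radiusY u < ⊤) (i j : Fin p) :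
    IsCompact (Distribution.dsupport (u i j)) := by
  refine Metric.isCompact_of_isClosed_isBounded Distribution.isClosed_dsupport ?_
  refine (Metric.isBounded_closedBall (x := (0 : ℝ)) (r := (radiusX u).toReal)).prod
    (Metric.isBounded_closedBall (x := (0 : ℝ)) (r := (radiusY u).toReal)) |>.subset ?_
  intro q hq
  have hq' := dsupport_subset_kernelSupport i j hq
  have h1 : ‖q.1‖ₑ ≤ radiusX u := le_iSup₂ (f := fun x _ => ‖x‖ₑ) q.1 ⟨q, hq', rfl⟩
  have h2 : ‖q.2‖ₑ ≤ radiusY u := le_iSup₂ (f := fun x _ => ‖x‖ₑ) q.2 ⟨q, hq', rfl⟩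
  refine ⟨?_, ?_⟩
  · simpa using ENNReal.toReal_mono hrx.ne h1
  · simpa using ENNReal.toReal_mono hry.ne h2

theorem pairable_tensor (hrx : radiusX u < ⊤) (hry : radiusY u < ⊤)
    (hf : SmoothNear (supportX u) f) (hg : SmoothNear (supportY u) g) (i j : Fin p) :
    Pairable (u i j) fun q => f q.1 * g q.2 := by
  obtain ⟨V, hV, hAV, hf⟩ := hf
  obtain ⟨W, hW, hAW, hg⟩ := hg
  refine pairable_of_contDiffOn (isCompact_dsupport hrx hry i j) (hV.prod hW) ?_
    ((hf.comp contDiffOn_fst fun q hq => hq.1).mul (hg.comp contDiffOn_snd fun q hq => hq.2))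
  intro q hq
  have hq' := dsupport_subset_kernelSupport i j hq
  exact ⟨hAV ⟨q, hq', rfl⟩, hAW ⟨q, hq', rfl⟩⟩

theorem moment_congr_left (hrx : radiusX u < ⊤) (hry : radiusY u < ⊤) {f' : ℝ → ℂ}
    (hf : SmoothNear (supportX u) f) (hg : SmoothNear (supportY u) g) {V : Set ℝ}
    (hV : IsOpen V) (hVu : supportX u ⊆ V) (h : ∀ x ∈ V, f' x = f x) :
    moment u f' g = moment u f g := by
  ext i j
  refine (pairing_congr ?_ (pairable_tensor hrx hry hf hg i j)).symm
  rw [eventually_nhdsSet_iff_exists]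
  refine ⟨Prod.fst ⁻¹' V, hV.preimage continuous_fst, fun q hq =>
    hVu ⟨q, dsupport_subset_kernelSupport i j hq, rfl⟩, fun q hq => ?_⟩
  rw [h q.1 hq]

theorem moment_congr_right (hrx : radiusX u < ⊤) (hry : radiusY u < ⊤) {g' : ℝ → ℂ}
    (hf : SmoothNear (supportX u) f) (hg : SmoothNear (supportY u) g) {V : Set ℝ}
    (hV : IsOpen V) (hVu : supportY u ⊆ V) (h : ∀ y ∈ V, g' y = g y) :
    moment u f g' = moment u f g := by
  ext i j
  refine (pairing_congr ?_ (pairable_tensor hrx hry hf hg i j)).symm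
  rw [eventually_nhdsSet_iff_exists]
  refine ⟨Prod.snd ⁻¹' V, hV.preimage continuous_snd, fun q hq =>
    hVu ⟨q, dsupport_subset_kernelSupport i j hq, rfl⟩, fun q hq => ?_⟩
  rw [h q.2 hq]

theorem moment_add_left (hrx : radiusX u < ⊤) (hry : radiusY u < ⊤) {f' : ℝ → ℂ}
    (hf : SmoothNear (supportX u) f) (hf' : SmoothNear (supportX u) f')
    (hg : SmoothNear (supportY u) g) (c : ℂ) :
    moment u (fun x => f x + c * f' x) g = moment u f g + c • moment u f' g := by
  ext i j
  have h := pairable_tensor hrx hry hf hg i j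
  have h' := pairable_tensor hrx hry hf' hg i j
  simp only [moment, Matrix.of_apply, Matrix.add_apply, Matrix.smul_apply, smul_eq_mul]
  rw [← pairing_const_mul h', ← pairing_add h (h'.const_mul c)]
  congr 1
  funext q
  ring

theorem moment_add_right (hrx : radiusX u < ⊤) (hry : radiusY u < ⊤) {g' : ℝ → ℂ}
    (hf : SmoothNear (supportX u) f) (hg : SmoothNear (supportY u) g)
    (hg' : SmoothNear (supportY u) g') (c : ℂ) :
    moment u f (fun y => g y + c * g' y) = moment u f g + c • moment u f g' := by
  ext i j
  have h := pairable_tensor hrx hry hf hg i j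
  have h' := pairable_tensor hrx hry hf hg' i j
  simp only [moment, Matrix.of_apply, Matrix.add_apply, Matrix.smul_apply, smul_eq_mul]
  rw [← pairing_const_mul h', ← pairing_add h (h'.const_mul c)]
  congr 1
  funext q
  ring

/-- The sesquilinear form on finite linear combinations with matrix coefficients. -/
theorem sesqForm_sum_smul (hrx : radiusX u < ⊤) (hry : radiusY u < ⊤) {ι κ : Type*}
    (s : Finset ι) (r : Finset κ) {F : ι → ℝ → ℂ} {K : κ → ℝ → ℂ}
    (hF : ∀ a, SmoothNear (supportX u) (F a)) (hK : ∀ b, SmoothNear (supportY u) (K b))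
    (M : ι → Matrix (Fin p) (Fin p) ℂ) (N : κ → Matrix (Fin p) (Fin p) ℂ) :
    sesqForm u (fun x => ∑ a ∈ s, F a x • M a) (fun y => ∑ b ∈ r, K b y • N b) =
      ∑ a ∈ s, ∑ b ∈ r, M a * moment u (F a) (K b) * (N b)ᵀ := by
  have key : ∀ i j k l, pairing (u k l) (fun q => (∑ a ∈ s, F a q.1 • M a) i k *
      (∑ b ∈ r, K b q.2 • N b) j l) =
      ∑ a ∈ s, ∑ b ∈ r, M a i k * moment u (F a) (K b) k l * N b j l := by
    intro i j k l
    have h1 : (fun q : ℝ × ℝ => (∑ a ∈ s, F a q.1 • M a) i k *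
        (∑ b ∈ r, K b q.2 • N b) j l) =
        fun q => ∑ a ∈ s, ∑ b ∈ r, (M a i k * N b j l) * (F a q.1 * K b q.2) := by
      funext q
      simp only [Matrix.sum_apply, Matrix.smul_apply, smul_eq_mul, Finset.sum_mul_sum]
      exact Finset.sum_congr rfl fun a _ => Finset.sum_congr rfl fun b _ => by ring
    have hp : ∀ a b, Pairable (u k l) fun q =>
        (M a i k * N b j l) * (F a q.1 * K b q.2) := fun a b =>
      (pairable_tensor hrx hry (hF a) (hK b) k l).const_mul _
    rw [h1, pairing_sum fun a _ => Pairable.sum fun b _ => hp a b]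
    refine Finset.sum_congr rfl fun a _ => ?_
    rw [pairing_sum fun b _ => hp a b]
    refine Finset.sum_congr rfl fun b _ => ?_
    rw [pairing_const_mul (pairable_tensor hrx hry (hF a) (hK b) k l), moment, Matrix.of_apply]
    ring
  ext i j
  simp only [sesqForm, Matrix.of_apply]
  simp only [key]
  simp only [Matrix.sum_apply, Matrix.mul_apply, Matrix.transpose_apply, Finset.sum_mul]
  rw [Finset.sum_comm]
  simp_rw [Finset.sum_comm (s := (Finset.univ : Finset (Fin p))) (t := s),
    Finset.sum_comm (s := (Finset.univ : Finset (Fin p))) (t := r)]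

end moments
end SatoToda
end

noncomputable section
namespace SatoToda

/-! ### Block matrices -/

section blocks

variable {p : ℕ} {G G' S₁ S₂ S₁' S₂' : BlockMatrix p} {H H' : ℕ → Matrix (Fin p) (Fin p) ℂ}

/-- The block transpose. -/
def blockTranspose (G : BlockMatrix p) : BlockMatrix p := fun k l => (G l k)ᵀ

theorem Quasidefinite.transpose (h : Quasidefinite G) : Quasidefinite (blockTranspose G) :=
  fun k => by
    have : truncation (blockTranspose G) k = (truncation G k)ᵀ := rfl
    rw [this, Matrix.det_transpose]
    exact h k

/-- A row of `N` blocks. -/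
def blockRow (N : ℕ) (X : ℕ → Matrix (Fin p) (Fin p) ℂ) :
    Matrix (Fin p) (Fin N × Fin p) ℂ := Matrix.of fun i b => X b.1 i b.2

theorem blockRow_mul_truncation (N : ℕ) (X : ℕ → Matrix (Fin p) (Fin p) ℂ) :
    blockRow N X * truncation G N =
      blockRow N fun l => ∑ k ∈ Finset.range N, X k * G k l := by
  ext i b
  simp only [Matrix.mul_apply, blockRow, truncation, Matrix.of_apply, Matrix.sum_apply,
    Fintype.sum_prod_type, Finset.sum_range]

/-- The truncation is invertible, so a matrix polynomial of degree below N orthogonal to 1, y, …,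
y^{N-1} vanishes. Both Darboux relations rest on this uniqueness principle. -/
theorem Quasidefinite.row_eq_zero (h : Quasidefinite G) {N : ℕ}
    {X : ℕ → Matrix (Fin p) (Fin p) ℂ}
    (hX : ∀ l < N, ∑ k ∈ Finset.range N, X k * G k l = 0) : ∀ k < N, X k = 0 := by
  have h0 : blockRow N X * truncation G N = 0 := by
    rw [blockRow_mul_truncation]
    ext i b
    exact congrFun (congrFun (hX b.1 b.1.2) i) b.2
  have h1 : blockRow N X = 0 := by
    have := congrArg (· * (truncation G N)⁻¹) h0
    simpa [Matrix.mul_nonsing_inv_cancel_right _ _ (isUnit_iff_ne_zero.2 (h N))] using this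
  intro k hk
  ext i j
  exact congrFun (congrFun h1 i) (⟨k, hk⟩, j)

theorem Quasidefinite.exists_row (h : Quasidefinite G) (N : ℕ)
    (R : ℕ → Matrix (Fin p) (Fin p) ℂ) :
    ∃ X : ℕ → Matrix (Fin p) (Fin p) ℂ,
      ∀ l < N, ∑ k ∈ Finset.range N, X k * G k l = R l := by
  let Y := blockRow N R * (truncation G N)⁻¹
  let X : ℕ → Matrix (Fin p) (Fin p) ℂ := fun k =>
    if hk : k < N then Matrix.of fun i j => Y i (⟨k, hk⟩, j) else 0
  have hXY : blockRow N X = Y := by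
    ext i b
    simp [blockRow, X]
  refine ⟨X, fun l hl => ?_⟩
  have h1 : blockRow N X * truncation G N = blockRow N R := by
    rw [hXY, Matrix.nonsing_inv_mul_cancel_right _ _ (isUnit_iff_ne_zero.2 (h N))]
  rw [blockRow_mul_truncation] at h1
  ext i j
  exact congrFun (congrFun h1 i) (⟨l, hl⟩, j)

/-- There are lower unitriangular rows orthogonal to the preceding columns. -/
theorem Quasidefinite.exists_lowerUnitriangular (h : Quasidefinite G) :
    ∃ S : BlockMatrix p, LowerUnitriangular S ∧
      ∀ n, ∀ l < n, ∑ k ∈ Finset.range (n + 1), S n k * G k l = 0 := by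
  -- Gram–Schmidt: `X n` holds the lower-order coefficients that make x^n orthogonal to y^l for l <
  -- n.
  choose X hX using fun n => h.exists_row n fun l => -G n l
  refine ⟨fun n k => if k < n then X n k else if k = n then 1 else 0,
    ⟨fun n => by simp, fun n m hnm => by simp [hnm.not_gt, hnm.ne']⟩, fun n l hl => ?_⟩
  rw [Finset.sum_range_succ]
  simp only [lt_self_iff_false, if_false, if_true, one_mul]
  rw [← eq_neg_iff_add_eq_zero, ← hX n l hl]
  exact Finset.sum_congr rfl fun k hk => by rw [if_pos (Finset.mem_range.1 hk)]

/-- The rows of the inverse of a lower unitriangular block matrix. -/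
def inverseRow (S : BlockMatrix p) (n : ℕ) : ℕ → Matrix (Fin p) (Fin p) ℂ :=
  fun m => (if n = m then 1 else 0) - ∑ k : Fin n, S n k * inverseRow S k m
termination_by n
decreasing_by exact k.2

theorem inverseRow_eq (S : BlockMatrix p) (n m : ℕ) : inverseRow S n m =
    (if n = m then 1 else 0) - ∑ k ∈ Finset.range n, S n k * inverseRow S k m := by
  rw [inverseRow, Finset.sum_range]

theorem LowerUnitriangular.exists_isInverse (hS : LowerUnitriangular S₁) :
    ∃ T : BlockMatrix p, LowerUnitriangular T ∧ IsInverse S₁ T := by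
  have h0 : ∀ n m, n < m → inverseRow S₁ n m = 0 := by
    intro n
    induction n using Nat.strong_induction_on with
    | _ n ih =>
      intro m hm
      rw [inverseRow_eq, if_neg hm.ne, Finset.sum_eq_zero, sub_zero]
      intro k hk
      rw [ih k (Finset.mem_range.1 hk) m ((Finset.mem_range.1 hk).trans hm), mul_zero]
  refine ⟨inverseRow S₁, ⟨fun n => ?_, h0⟩, fun n m => ?_⟩
  · rw [inverseRow_eq, if_pos rfl, Finset.sum_eq_zero, sub_zero]
    intro k hk
    rw [h0 k n (Finset.mem_range.1 hk), mul_zero]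
  · rw [Finset.sum_range_succ, hS.1, one_mul, inverseRow_eq S₁ n m]
    abel

/-- Forward substitution; used to cancel a unitriangular factor without forming its left inverse. -/
theorem LowerUnitriangular.eq_zero (hS : LowerUnitriangular S₁)
    {D : ℕ → Matrix (Fin p) (Fin p) ℂ}
    (hD : ∀ n, ∑ k ∈ Finset.range (n + 1), S₁ n k * D k = 0) (n : ℕ) : D n = 0 := by
  induction n using Nat.strong_induction_on with
  | _ n ih =>
    have h := hD n
    rwa [Finset.sum_range_succ, hS.1, one_mul, Finset.sum_eq_zero, zero_add] at h
    intro k hk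
    rw [ih k (Finset.mem_range.1 hk), mul_zero]

theorem LowerUnitriangular.sum_range_eq (hS : LowerUnitriangular S₁) {n N : ℕ} (h : n < N)
    (D : ℕ → Matrix (Fin p) (Fin p) ℂ) :
    ∑ k ∈ Finset.range N, S₁ n k * D k = ∑ k ∈ Finset.range (n + 1), S₁ n k * D k := by
  refine (Finset.sum_subset (Finset.range_subset_range.2 h) fun k _ hk => ?_).symm
  rw [hS.2 n k (by simpa using hk), zero_mul]

/-- Exchanges the variables x and y, so that each statement about the first family yields one about
the second. -/
theorem IsGaussBorel.transpose (h : IsGaussBorel G S₁ H S₂) :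
    IsGaussBorel (blockTranspose G) S₂ (fun n => (H n)ᵀ) S₁ := by
  obtain ⟨h1, h2, T₁, T₂, hT₁, hT₂, hi₁, hi₂, hG⟩ := h
  refine ⟨h2, h1, T₂, T₁, hT₂, hT₁, hi₂, hi₁, fun k l => ?_⟩
  -- The sum for `G l k` stops at `l`, while the transposed factorization must stop at `k`; both
  -- extend by zeros to a common range.
  have h3 : G l k = ∑ m ∈ Finset.range (k + l + 1), T₁ l m * H m * (T₂ k m)ᵀ := by
    rw [hG]
    refine Finset.sum_subset (Finset.range_subset_range.2 (by omega)) fun m _ hm => ?_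
    rw [hT₁.2 l m (by simpa using hm), zero_mul, zero_mul]
  rw [blockTranspose, h3, Matrix.transpose_sum]
  refine (Finset.sum_subset (Finset.range_subset_range.2 (by omega)) fun m _ hm => ?_).symm.trans
    (Finset.sum_congr rfl fun m _ => ?_)
  · rw [hT₂.2 k m (by simpa using hm)]
    simp
  · simp [Matrix.transpose_mul, mul_assoc]

/-- The rows of `S₁ G`. -/
theorem IsGaussBorel.exists_left (h : IsGaussBorel G S₁ H S₂) :
    ∃ T₂ : BlockMatrix p, LowerUnitriangular T₂ ∧
      ∀ n l, ∑ k ∈ Finset.range (n + 1), S₁ n k * G k l = H n * (T₂ l n)ᵀ := by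
  obtain ⟨h1, h2, T₁, T₂, hT₁, hT₂, hi₁, hi₂, hG⟩ := h
  refine ⟨T₂, hT₂, fun n l => ?_⟩
  have h3 : ∀ k ∈ Finset.range (n + 1), S₁ n k * G k l =
      ∑ m ∈ Finset.range (n + 1), S₁ n k * T₁ k m * H m * (T₂ l m)ᵀ := by
    intro k hk
    rw [hG, Finset.mul_sum]
    refine (Finset.sum_congr rfl fun m _ => by simp only [mul_assoc]).trans
      (Finset.sum_subset (Finset.range_subset_range.2 (by simpa using hk)) fun m _ hm => ?_)
    rw [hT₁.2 k m (by simpa using hm)]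
    simp
  rw [Finset.sum_congr rfl h3, Finset.sum_comm]
  simp_rw [← Finset.sum_mul, hi₁ n]
  rw [Finset.sum_eq_single n]
  · simp
  · intro m _ hm
    simp [hm.symm]
  · simp

/-- S₁G = H S₂^{-⊤} is block upper triangular: this is the orthogonality ⟨P_n, y^l⟩ = 0. Its
diagonal blocks are the `H n`. -/
theorem IsGaussBorel.left_of_lt (h : IsGaussBorel G S₁ H S₂) {n l : ℕ} (hl : l < n) :
    ∑ k ∈ Finset.range (n + 1), S₁ n k * G k l = 0 := by
  obtain ⟨T, hT, h⟩ := h.exists_left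
  rw [h, hT.2 l n hl, Matrix.transpose_zero, mul_zero]

theorem IsGaussBorel.left_self (h : IsGaussBorel G S₁ H S₂) (n : ℕ) :
    ∑ k ∈ Finset.range (n + 1), S₁ n k * G k n = H n := by
  obtain ⟨T, hT, h⟩ := h.exists_left
  rw [h, hT.1, Matrix.transpose_one, mul_one]

/-- If v H_n = 0, then v P_n is orthogonal to 1, …, y^n and so vanishes, although its leading
coefficient is v. -/
theorem Quasidefinite.isUnit_det (hG : Quasidefinite G) (h : IsGaussBorel G S₁ H S₂) (n : ℕ) :
    IsUnit (H n).det := by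
  by_contra hn
  rw [isUnit_iff_ne_zero, not_not, ← Matrix.exists_vecMul_eq_zero_iff] at hn
  obtain ⟨v, hv, hvH⟩ := hn
  let V : Matrix (Fin p) (Fin p) ℂ := Matrix.of fun _ => v
  have hVH : V * H n = 0 := by
    ext i j
    exact congrFun hvH j
  have h0 := hG.row_eq_zero (N := n + 1) (X := fun k => V * S₁ n k) (fun l hl => by
    simp only [mul_assoc, ← Finset.mul_sum]
    rcases (Nat.lt_succ_iff.1 hl).lt_or_eq with hl | rfl
    · rw [h.left_of_lt hl, mul_zero]
    · rw [h.left_self, hVH]) n n.lt_succ_self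
  rw [h.1.1, mul_one] at h0
  obtain ⟨i, hi⟩ := Function.ne_iff.1 hv
  exact hi (congrFun (congrFun h0 i) i)

/-- Gram–Schmidt on rows and on columns gives S₁ and S₂ with S₁ G upper and G S₂ᵀ lower triangular.
Then S₁ G S₂ᵀ is both, hence diagonal, and the unitriangular factors are inverted. -/
theorem Quasidefinite.exists_isGaussBorel (hG : Quasidefinite G) :
    ∃ S₁ H S₂, IsGaussBorel G S₁ H S₂ := by
  obtain ⟨S₁, hS₁, h1⟩ := hG.exists_lowerUnitriangular
  obtain ⟨S₂, hS₂, h2⟩ := hG.transpose.exists_lowerUnitriangular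
  obtain ⟨T₁, hT₁, hi₁⟩ := hS₁.exists_isInverse
  obtain ⟨T₂, hT₂, hi₂⟩ := hS₂.exists_isInverse
  let B : BlockMatrix p := fun n l => ∑ k ∈ Finset.range (n + 1), S₁ n k * G k l
  let H : ℕ → Matrix (Fin p) (Fin p) ℂ := fun n => B n n
  have hB0 : ∀ n l, l < n → B n l = 0 := h1
  have h2' : ∀ n, ∀ l < n, ∑ k ∈ Finset.range (n + 1), G l k * (S₂ n k)ᵀ = 0 := by
    intro n l hl
    have := congrArg Matrix.transpose (h2 n l hl)
    simpa [Matrix.transpose_sum, blockTranspose] using this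
  have hA : ∀ n m, ∑ l ∈ Finset.range (m + 1), B n l * (S₂ m l)ᵀ =
      if n = m then H n else 0 := by
    intro n m
    rcases lt_trichotomy n m with hnm | rfl | hnm
    · rw [if_neg hnm.ne]
      simp only [B, Finset.sum_mul]
      rw [Finset.sum_comm]
      refine Finset.sum_eq_zero fun k hk => ?_
      simp only [mul_assoc, ← Finset.mul_sum]
      rw [h2' m k (by have := Finset.mem_range.1 hk; omega), mul_zero]
    · rw [if_pos rfl, Finset.sum_range_succ, hS₂.1, Matrix.transpose_one, mul_one,
        Finset.sum_eq_zero, zero_add]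
      intro l hl
      rw [hB0 n l (Finset.mem_range.1 hl), zero_mul]
    · rw [if_neg hnm.ne']
      refine Finset.sum_eq_zero fun l hl => ?_
      rw [hB0 n l (by have := Finset.mem_range.1 hl; omega), zero_mul]
  -- Both sides have the same product with S₂ᵀ on the right; `eq_zero`, applied to the transposed
  -- difference, cancels that factor.
  have hBT : ∀ n l, B n l = H n * (T₂ l n)ᵀ := by
    intro n l
    have := hS₂.eq_zero (D := fun l => (B n l - H n * (T₂ l n)ᵀ)ᵀ) (fun m => by
      have e : ∀ l, S₂ m l * (B n l - H n * (T₂ l n)ᵀ)ᵀ =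
          (B n l * (S₂ m l)ᵀ)ᵀ - (H n * (S₂ m l * T₂ l n)ᵀ)ᵀ := by
        intro l
        simp only [Matrix.transpose_sub, Matrix.transpose_mul, Matrix.transpose_transpose, mul_sub,
          mul_assoc]
      simp only [e]
      rw [Finset.sum_sub_distrib, ← Matrix.transpose_sum, ← Matrix.transpose_sum, ← Finset.mul_sum,
        ← Matrix.transpose_sum, hA, hi₂]
      by_cases hnm : n = m
      · simp [hnm]
      · simp [hnm, Ne.symm hnm]) l
    rwa [Matrix.transpose_eq_zero, sub_eq_zero] at this
  refine ⟨S₁, H, S₂, hS₁, hS₂, T₁, T₂, hT₁, hT₂, hi₁, hi₂, fun k l => ?_⟩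
  rw [← sub_eq_zero]
  refine hS₁.eq_zero (D := fun k => G k l -
    ∑ m ∈ Finset.range (k + 1), T₁ k m * H m * (T₂ l m)ᵀ) (fun n => ?_) k
  have h3 : ∀ k ∈ Finset.range (n + 1),
      S₁ n k * ∑ m ∈ Finset.range (k + 1), T₁ k m * H m * (T₂ l m)ᵀ =
      ∑ m ∈ Finset.range (n + 1), S₁ n k * T₁ k m * H m * (T₂ l m)ᵀ := by
    intro k hk
    rw [Finset.mul_sum]
    refine (Finset.sum_congr rfl fun m _ => by simp only [mul_assoc]).trans
      (Finset.sum_subset (Finset.range_subset_range.2 (by simpa using hk)) fun m _ hm => ?_)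
    rw [hT₁.2 k m (by simpa using hm)]
    simp
  simp only [mul_sub]
  rw [Finset.sum_sub_distrib, Finset.sum_congr rfl h3, Finset.sum_comm (s := Finset.range (n + 1))]
  simp_rw [← Finset.sum_mul, hi₁ n]
  rw [Finset.sum_eq_single (s := Finset.range (n + 1)) (a := n)
    (f := fun m => (if n = m then (1 : Matrix (Fin p) (Fin p) ℂ) else 0) * H m * (T₂ l m)ᵀ)]
  · rw [if_pos rfl, one_mul, ← hBT, sub_self]
  · intro m _ hm
    simp [hm.symm]
  · simp

/-- Only existence is needed: every later property is derived from `IsGaussBorel` and holds for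
whichever factorization was chosen. -/
theorem Quasidefinite.isGaussBorel_gaussBorel (hG : Quasidefinite G) :
    IsGaussBorel G (gaussBorel G).1 (gaussBorel G).2.1 (gaussBorel G).2.2 := by
  have h : ∃ F : BlockMatrix p × (ℕ → Matrix (Fin p) (Fin p) ℂ) × BlockMatrix p,
      IsGaussBorel G F.1 F.2.1 F.2.2 := by
    obtain ⟨S₁, H, S₂, h⟩ := hG.exists_isGaussBorel
    exact ⟨(S₁, H, S₂), h⟩
  rw [gaussBorel, dif_pos h]
  exact h.choose_spec

/-! ### Darboux transformations -/

/-- Effect of multiplication of the measure by `1 - x / z` on the biorthogonal polynomials,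
evaluated at `z`. -/
theorem IsGaussBorel.eval_succ (h : IsGaussBorel G S₁ H S₂) (h' : IsGaussBorel G' S₁' H' S₂')
    (hG : Quasidefinite G) {z : ℂ} (hz : z ≠ 0)
    (hGG : ∀ k l, G' k l = G k l - z⁻¹ • G (k + 1) l) (n : ℕ) :
    ∑ k ∈ Finset.range (n + 2), z ^ k • S₁ (n + 1) k =
      z • (H' n * (H n)⁻¹ * ∑ k ∈ Finset.range (n + 1), z ^ k • S₁ n k) := by
  set M := z • (H' n * (H n)⁻¹) with hM
  -- `X k` is the coefficient of x^k in (x - z)P'_n - P_{n+1} + M P_n. `M` is fixed by requiring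
  -- orthogonality to y^n: multiplication by x - z turns the pairing by G into -z times the pairing
  -- by G', so M H_n = z H'_n.
  let X : ℕ → Matrix (Fin p) (Fin p) ℂ := fun k =>
    (if k = 0 then 0 else S₁' n (k - 1)) - z • S₁' n k - S₁ (n + 1) k + M * S₁ n k
  have hX : ∀ f : ℕ → Matrix (Fin p) (Fin p) ℂ, ∑ k ∈ Finset.range (n + 2), X k * f k =
      ∑ k ∈ Finset.range (n + 1), S₁' n k * (f (k + 1) - z • f k) -
        ∑ k ∈ Finset.range (n + 2), S₁ (n + 1) k * f k +
        M * ∑ k ∈ Finset.range (n + 1), S₁ n k * f k := by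
    intro f
    simp only [X, add_mul, sub_mul, Finset.sum_add_distrib, Finset.sum_sub_distrib, mul_sub]
    rw [Finset.sum_range_succ' (fun k => (if k = 0 then 0 else S₁' n (k - 1)) * f k)]
    simp only [smul_mul_assoc, mul_smul_comm, ← Finset.smul_sum, mul_assoc, ← Finset.mul_sum]
    rw [h.1.sum_range_eq (n := n) (N := n + 2) (by omega),
      h'.1.sum_range_eq (n := n) (N := n + 2) (by omega)]
    simp
  -- The monic leading terms cancel, so the degree is at most n.
  have hlast : X (n + 1) = 0 := by
    simp [X, h.1.1, h'.1.1, h.1.2 n (n + 1) n.lt_succ_self, h'.1.2 n (n + 1) n.lt_succ_self]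
  have hGz : ∀ k l, G (k + 1) l - z • G k l = -(z • G' k l) := by
    intro k l
    rw [hGG, smul_sub, smul_inv_smul₀ hz, neg_sub]
  have hsum : ∀ l < n + 1, ∑ k ∈ Finset.range (n + 1), X k * G k l = 0 := by
    intro l hl
    have h1 := hX fun k => G k l
    rw [Finset.sum_range_succ, hlast, zero_mul, add_zero, h.left_of_lt hl, sub_zero] at h1
    rw [h1]
    simp only [hGz, mul_neg, mul_smul_comm, Finset.sum_neg_distrib, ← Finset.smul_sum]
    rcases (Nat.lt_succ_iff.1 hl).lt_or_eq with hl | rfl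
    · rw [h.left_of_lt hl, h'.left_of_lt hl]
      simp
    · rw [h.left_self, h'.left_self, hM, smul_mul_assoc,
        Matrix.nonsing_inv_mul_cancel_right _ _ (hG.isUnit_det h l), neg_add_cancel]
  have hX0 := hG.row_eq_zero hsum
  -- Evaluation at x = z, where the factor x - z disappears.
  have h2 := hX fun k => z ^ k • 1
  rw [Finset.sum_range_succ, hlast, zero_mul, add_zero, Finset.sum_eq_zero
    fun k hk => by rw [hX0 k (Finset.mem_range.1 hk), zero_mul]] at h2
  have h3 : ∀ k, (z ^ (k + 1) • 1 - z • z ^ k • 1 : Matrix (Fin p) (Fin p) ℂ) = 0 := by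
    intro k
    rw [smul_smul, pow_succ', sub_self]
  simp only [h3, mul_zero, Finset.sum_const_zero, zero_sub, mul_smul_comm, mul_one] at h2
  rw [eq_comm, neg_add_eq_zero] at h2
  rw [h2, hM, smul_mul_assoc]

/-- Effect of division of the measure by `1 - y / z` on the pairings of the biorthogonal
polynomials with the constants. -/
theorem IsGaussBorel.first_succ (h : IsGaussBorel G S₁ H S₂) (h' : IsGaussBorel G' S₁' H' S₂')
    (hG : Quasidefinite G) {c : ℂ} (hGG : ∀ k l, G k l = G' k l - c • G' k (l + 1)) (n : ℕ) :
    ∑ k ∈ Finset.range (n + 2), S₁ (n + 1) k * G' k 0 =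
      c • (H' (n + 1) * (H n)⁻¹ * ∑ k ∈ Finset.range (n + 1), S₁ n k * G' k 0) := by
  set M := c • (H' (n + 1) * (H n)⁻¹) with hM
  -- Coefficients of P'_{n+1} - P_{n+1} + M P_n. For l ≤ n, orthogonality under G' gives ⟨P'_{n+1},
  -- y^l⟩_G = -c⟨P'_{n+1}, y^{l+1}⟩_{G'}, nonzero at most for l = n, which dictates M H_n = c
  -- H'_{n+1}.
  let X : ℕ → Matrix (Fin p) (Fin p) ℂ := fun k =>
    S₁' (n + 1) k - S₁ (n + 1) k + M * S₁ n k
  have hX : ∀ f : ℕ → Matrix (Fin p) (Fin p) ℂ, ∑ k ∈ Finset.range (n + 2), X k * f k =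
      ∑ k ∈ Finset.range (n + 2), S₁' (n + 1) k * f k -
        ∑ k ∈ Finset.range (n + 2), S₁ (n + 1) k * f k +
        M * ∑ k ∈ Finset.range (n + 1), S₁ n k * f k := by
    intro f
    simp only [X, add_mul, sub_mul, Finset.sum_add_distrib, Finset.sum_sub_distrib]
    simp only [mul_assoc, ← Finset.mul_sum]
    rw [h.1.sum_range_eq (n := n) (N := n + 2) (by omega)]
  have hlast : X (n + 1) = 0 := by
    simp [X, h.1.1, h'.1.1, h.1.2 n (n + 1) n.lt_succ_self]
  have hsum : ∀ l < n + 1, ∑ k ∈ Finset.range (n + 1), X k * G k l = 0 := by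
    intro l hl
    have h1 := hX fun k => G k l
    rw [Finset.sum_range_succ, hlast, zero_mul, add_zero, h.left_of_lt hl, sub_zero] at h1
    rw [h1]
    have h4 : ∑ k ∈ Finset.range (n + 2), S₁' (n + 1) k * G k l =
        -(c • ∑ k ∈ Finset.range (n + 2), S₁' (n + 1) k * G' k (l + 1)) := by
      simp only [hGG, mul_sub, mul_smul_comm, Finset.sum_sub_distrib, ← Finset.smul_sum]
      rw [h'.left_of_lt hl, zero_sub]
    rw [h4]
    rcases (Nat.lt_succ_iff.1 hl).lt_or_eq with hl | rfl
    · rw [h.left_of_lt hl, h'.left_of_lt (Nat.succ_lt_succ hl)]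
      simp
    · rw [h.left_self, h'.left_self, hM, smul_mul_assoc,
        Matrix.nonsing_inv_mul_cancel_right _ _ (hG.isUnit_det h l), neg_add_cancel]
  have hX0 := hG.row_eq_zero hsum
  -- Pairing with I under G' removes P'_{n+1}, whose index is positive.
  have h2 := hX fun k => G' k 0
  rw [Finset.sum_range_succ, hlast, zero_mul, add_zero, Finset.sum_eq_zero
    fun k hk => by rw [hX0 k (Finset.mem_range.1 hk), zero_mul], h'.left_of_lt n.succ_pos,
    zero_sub, eq_comm, neg_add_eq_zero] at h2
  rw [h2, hM, smul_mul_assoc]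

end blocks
end SatoToda
end

noncomputable section
namespace SatoToda

/-! ### Action of the Miwa shifts on Gram matrices and second kind functions. -/

section flows

variable {p : ℕ} {u : KernelMatrix p}

/-- The flow `t` multiplies the kernel by a function smooth near its support. -/
def SmoothFlow (u : KernelMatrix p) (t : Times) : Prop :=
  SmoothNear (supportX u) (fun x => Complex.exp (timeFunction t.1 x)) ∧
    SmoothNear (supportY u) (fun y => Complex.exp (-timeFunction t.2 y))

theorem SmoothFlow.flowForm_sum_smul (hrx : radiusX u < ⊤) (hry : radiusY u < ⊤) {t : Times}
    (ht : SmoothFlow u t) {ι κ : Type*} (s : Finset ι) (r : Finset κ)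
    {F : ι → ℝ → ℂ} {K : κ → ℝ → ℂ}
    (hF : ∀ a, SmoothNear (supportX u) (F a)) (hK : ∀ b, SmoothNear (supportY u) (K b))
    (M : ι → Matrix (Fin p) (Fin p) ℂ) (N : κ → Matrix (Fin p) (Fin p) ℂ) :
    flowForm u t (fun x => ∑ a ∈ s, F a x • M a) (fun y => ∑ b ∈ r, K b y • N b) =
      ∑ a ∈ s, ∑ b ∈ r, M a * moment u (fun x => Complex.exp (timeFunction t.1 x) * F a x)
        (fun y => Complex.exp (-timeFunction t.2 y) * K b y) * (N b)ᵀ := by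
  rw [flowForm, ← sesqForm_sum_smul hrx hry s r (fun a => ht.1.mul (hF a))
    (fun b => ht.2.mul (hK b)) M N]
  simp only [Finset.smul_sum, smul_smul]

theorem SmoothFlow.gram_eq (hrx : radiusX u < ⊤) (hry : radiusY u < ⊤) {t : Times}
    (ht : SmoothFlow u t) (k l : ℕ) :
    gram u t k l = moment u (fun x => Complex.exp (timeFunction t.1 x) * (x : ℂ) ^ k)
        (fun y => Complex.exp (-timeFunction t.2 y) * (y : ℂ) ^ l) := by
  unfold gram
  simpa using ht.flowForm_sum_smul hrx hry {()} {()} (fun _ => .ofReal_pow k)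
    (fun _ => .ofReal_pow l) (fun _ => 1) (fun _ => 1)

/-- Multiplication of the weight by `1 - x / z`. -/
theorem gram_eq_sub_left (hrx : radiusX u < ⊤) (hry : radiusY u < ⊤) {t t' : Times}
    (ht : SmoothFlow u t) (ht' : SmoothFlow u t') {z : ℂ} (hz : supportX u ⊆ interval z)
    (h1 : ∀ x ∈ interval z, Complex.exp (timeFunction t'.1 x) =
      Complex.exp (timeFunction t.1 x) * (1 - z⁻¹ * x)) (h2 : t'.2 = t.2) (k l : ℕ) :
    gram u t' k l = gram u t k l - z⁻¹ • gram u t (k + 1) l := by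
  have hk := fun k => ht.1.mul (.ofReal_pow (A := supportX u) k)
  have hl := ht.2.mul (.ofReal_pow (A := supportY u) l)
  rw [ht.gram_eq hrx hry, ht.gram_eq hrx hry, ht'.gram_eq hrx hry, h2, sub_eq_add_neg,
    ← neg_smul, ← moment_add_left hrx hry (hk k) (hk (k + 1)) hl]
  refine (moment_congr_left hrx hry (ht'.1.mul (.ofReal_pow k)) hl (isOpen_interval z) hz
    fun x hx => ?_).symm
  rw [h1 x hx]
  ring

/-- Multiplication of the weight by `1 - y / z`. -/
theorem gram_eq_sub_right (hrx : radiusX u < ⊤) (hry : radiusY u < ⊤) {t t' : Times}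
    (ht : SmoothFlow u t) (ht' : SmoothFlow u t') {z : ℂ} (hz : supportY u ⊆ interval z)
    (h1 : t'.1 = t.1) (h2 : ∀ y ∈ interval z, Complex.exp (-timeFunction t'.2 y) =
      Complex.exp (-timeFunction t.2 y) * (1 - z⁻¹ * y)) (k l : ℕ) :
    gram u t' k l = gram u t k l - z⁻¹ • gram u t k (l + 1) := by
  have hk := ht.1.mul (.ofReal_pow (A := supportX u) k)
  have hl := fun l => ht.2.mul (.ofReal_pow (A := supportY u) l)
  rw [ht.gram_eq hrx hry, ht.gram_eq hrx hry, ht'.gram_eq hrx hry, h1, sub_eq_add_neg,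
    ← neg_smul, ← moment_add_right hrx hry hk (hl l) (hl (l + 1))]
  refine (moment_congr_right hrx hry hk (ht'.2.mul (.ofReal_pow l)) (isOpen_interval z) hz
    fun y hy => ?_).symm
  rw [h2 y hy]
  ring

variable {t : Times}

theorem smoothFlow_of_finite (ht₁ : (Function.support t.1).Finite)
    (ht₂ : (Function.support t.2).Finite) : SmoothFlow u t :=
  ⟨.exp_timeFunction ht₁, .exp_neg_timeFunction ht₂⟩

theorem smoothNear_one_sub {A : Set ℝ} (z : ℂ) :
    SmoothNear A fun x : ℝ => 1 - z⁻¹ * (x : ℂ) :=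
  .of_contDiff (contDiff_const.sub (contDiff_const.mul Complex.ofRealCLM.contDiff))

theorem smoothNear_mul_inv_sub {A : Set ℝ} {z : ℂ} (hA : A ⊆ interval z) :
    SmoothNear A fun x : ℝ => z * (z - (x : ℂ))⁻¹ :=
  (SmoothNear.of_contDiff contDiff_const).mul (.inv_sub hA)

section shifts

variable (ht₁ : (Function.support t.1).Finite) (ht₂ : (Function.support t.2).Finite) {z : ℂ}
include ht₁ ht₂

theorem smoothFlow_sub_miwaX (hz : supportX u ⊆ interval z) : SmoothFlow u (t - miwaX z) :=
  ⟨((SmoothNear.exp_timeFunction ht₁).mul (smoothNear_one_sub z)).congr (isOpen_interval z) hz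
    fun _ hx => exp_timeFunction_sub_miwa ht₁ hx, by
    simpa [miwaX] using SmoothNear.exp_neg_timeFunction ht₂⟩

theorem smoothFlow_add_miwaX (hz : supportX u ⊆ interval z) : SmoothFlow u (t + miwaX z) :=
  ⟨((SmoothNear.exp_timeFunction ht₁).mul (smoothNear_mul_inv_sub hz)).congr
    (isOpen_interval z) hz fun _ hx => exp_timeFunction_add_miwa ht₁ hx, by
    simpa [miwaX] using SmoothNear.exp_neg_timeFunction ht₂⟩

theorem smoothFlow_sub_miwaY (hz : supportY u ⊆ interval z) : SmoothFlow u (t - miwaY z) :=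
  ⟨by simpa [miwaY] using SmoothNear.exp_timeFunction ht₁,
    ((SmoothNear.exp_neg_timeFunction ht₂).mul (smoothNear_mul_inv_sub hz)).congr
      (isOpen_interval z) hz fun _ hx => exp_neg_timeFunction_sub_miwa ht₂ hx⟩

theorem smoothFlow_add_miwaY (hz : supportY u ⊆ interval z) : SmoothFlow u (t + miwaY z) :=
  ⟨by simpa [miwaY] using SmoothNear.exp_timeFunction ht₁,
    ((SmoothNear.exp_neg_timeFunction ht₂).mul (smoothNear_one_sub z)).congr
      (isOpen_interval z) hz fun _ hx => exp_neg_timeFunction_add_miwa ht₂ hx⟩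

variable (hrx : radiusX u < ⊤) (hry : radiusY u < ⊤)
include hrx hry

theorem gram_sub_miwaX (hz : supportX u ⊆ interval z) (k l : ℕ) :
    gram u (t - miwaX z) k l = gram u t k l - z⁻¹ • gram u t (k + 1) l :=
  gram_eq_sub_left hrx hry (smoothFlow_of_finite ht₁ ht₂) (smoothFlow_sub_miwaX ht₁ ht₂ hz) hz
    (fun _ hx => exp_timeFunction_sub_miwa ht₁ hx) (by simp [miwaX]) k l

/-- Adding `miwaX z` divides the weight by 1 - x/z, so here the unshifted kernel is the linear
multiple of the shifted one. For the second times the sign in exp(-t₂) exchanges the two shifts. -/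
theorem gram_add_miwaX (hz : supportX u ⊆ interval z) (k l : ℕ) :
    gram u t k l = gram u (t + miwaX z) k l - z⁻¹ • gram u (t + miwaX z) (k + 1) l :=
  gram_eq_sub_left hrx hry (smoothFlow_add_miwaX ht₁ ht₂ hz) (smoothFlow_of_finite ht₁ ht₂) hz
    (fun x hx => by
      have h := sub_ne_zero_of_mem_interval hx
      have h' := ne_zero_of_mem_interval hx
      rw [show (t + miwaX z).1 = t.1 + miwa z from rfl, exp_timeFunction_add_miwa ht₁ hx]
      field_simp) (by simp [miwaX]) k l

theorem gram_sub_miwaY (hz : supportY u ⊆ interval z) (k l : ℕ) :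
    gram u t k l = gram u (t - miwaY z) k l - z⁻¹ • gram u (t - miwaY z) k (l + 1) :=
  gram_eq_sub_right hrx hry (smoothFlow_sub_miwaY ht₁ ht₂ hz) (smoothFlow_of_finite ht₁ ht₂) hz
    (by simp [miwaY]) (fun x hx => by
      have h := sub_ne_zero_of_mem_interval hx
      have h' := ne_zero_of_mem_interval hx
      rw [show (t - miwaY z).2 = t.2 - miwa z from rfl, exp_neg_timeFunction_sub_miwa ht₂ hx]
      field_simp) k l

theorem gram_add_miwaY (hz : supportY u ⊆ interval z) (k l : ℕ) :
    gram u (t + miwaY z) k l = gram u t k l - z⁻¹ • gram u t k (l + 1) :=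
  gram_eq_sub_right hrx hry (smoothFlow_of_finite ht₁ ht₂) (smoothFlow_add_miwaY ht₁ ht₂ hz) hz
    (by simp [miwaY]) (fun _ hx => exp_neg_timeFunction_add_miwa ht₂ hx) k l

/-- On the interval, 1/(z - x) is z⁻¹ times the factor by which the shift multiplies the weight, so
the Cauchy kernel is absorbed into the flow. -/
theorem secondKindTwo_transpose_eq (hz : supportX u ⊆ interval z) (hz0 : z ≠ 0) (n : ℕ) :
    (secondKindTwo u t n z)ᵀ = z⁻¹ • ∑ l ∈ Finset.range (n + 1),
      gram u (t + miwaX z) 0 l * (gbS₂ u t n l)ᵀ := by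
  have h := (smoothFlow_of_finite (u := u) ht₁ ht₂).flowForm_sum_smul hrx hry {()}
    (Finset.range (n + 1)) (fun _ => .inv_sub hz) (fun l => .ofReal_pow l) (fun _ => 1)
    (fun l => gbS₂ u t n l)
  simp only [Finset.sum_singleton, one_mul] at h
  rw [secondKindTwo, Matrix.transpose_transpose]
  refine h.trans ?_
  rw [Finset.smul_sum]
  refine Finset.sum_congr rfl fun l _ => ?_
  have ht' := smoothFlow_add_miwaX ht₁ ht₂ hz
  rw [ht'.gram_eq hrx hry, ← smul_mul_assoc]
  congr 1
  have hX := ht'.1.mul (.ofReal_pow (A := supportX u) 0)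
  have hY := ht'.2.mul (.ofReal_pow (A := supportY u) l)
  have h0 : SmoothNear (supportX u) fun _ => (0 : ℂ) := .of_contDiff contDiff_const
  -- Homogeneity in the first argument, obtained from additivity with zero first summand.
  have h1 := moment_add_left hrx hry h0 hX hY z⁻¹
  have h2 : moment u (fun _ => 0) (fun y : ℝ =>
      Complex.exp (-timeFunction (t + miwaX z).2 y) * (y : ℂ) ^ l) = 0 := by
    ext i j
    simpa [moment] using pairing_zero
  rw [h2, zero_add] at h1
  rw [← h1, show (t + miwaX z).2 = t.2 by simp [miwaX]]
  refine (moment_congr_left hrx hry ((SmoothNear.exp_timeFunction ht₁).mul (.inv_sub hz))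
    ((SmoothNear.exp_neg_timeFunction ht₂).mul (.ofReal_pow l)) (isOpen_interval z) hz
    fun x hx => ?_).symm
  rw [show (t + miwaX z).1 = t.1 + miwa z from rfl, exp_timeFunction_add_miwa ht₁ hx, pow_zero,
    mul_one, zero_add]
  field_simp

theorem secondKindOne_eq (hz : supportY u ⊆ interval z) (hz0 : z ≠ 0) (n : ℕ) :
    secondKindOne u t n z = z⁻¹ • ∑ k ∈ Finset.range (n + 1),
      gbS₁ u t n k * gram u (t - miwaY z) k 0 := by
  have h := (smoothFlow_of_finite (u := u) ht₁ ht₂).flowForm_sum_smul hrx hry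
    (Finset.range (n + 1)) {()} (fun k => .ofReal_pow k) (fun _ => .inv_sub hz)
    (fun k => gbS₁ u t n k) (fun _ => 1)
  simp only [Finset.sum_singleton, Matrix.transpose_one, mul_one] at h
  rw [secondKindOne]
  refine h.trans ?_
  rw [Finset.smul_sum]
  refine Finset.sum_congr rfl fun k _ => ?_
  have ht' := smoothFlow_sub_miwaY ht₁ ht₂ hz
  rw [ht'.gram_eq hrx hry, ← mul_smul_comm]
  congr 1
  have hX := ht'.1.mul (.ofReal_pow (A := supportX u) k)
  have hY := ht'.2.mul (.ofReal_pow (A := supportY u) 0)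
  have h0 : SmoothNear (supportY u) fun _ => (0 : ℂ) := .of_contDiff contDiff_const
  have h1 := moment_add_right hrx hry hX h0 hY z⁻¹
  have h2 : moment u (fun x : ℝ =>
      Complex.exp (timeFunction (t - miwaY z).1 x) * (x : ℂ) ^ k) (fun _ => 0) = 0 := by
    ext i j
    simpa [moment] using pairing_zero
  rw [h2, zero_add] at h1
  rw [← h1, show (t - miwaY z).1 = t.1 by simp [miwaY]]
  refine (moment_congr_right hrx hry ((SmoothNear.exp_timeFunction ht₁).mul (.ofReal_pow k))
    ((SmoothNear.exp_neg_timeFunction ht₂).mul (.inv_sub hz)) (isOpen_interval z) hz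
    fun x hx => ?_).symm
  rw [show (t - miwaY z).2 = t.2 - miwa z from rfl, exp_neg_timeFunction_sub_miwa ht₂ hx, pow_zero,
    mul_one, zero_add]
  field_simp

end shifts

/-! ### Sato formulas -/

theorem Quasidefinite.isGaussBorel_gram (h : Quasidefinite (gram u t)) :
    IsGaussBorel (gram u t) (gbS₁ u t) (quasiTau u t) (gbS₂ u t) :=
  h.isGaussBorel_gaussBorel

theorem Quasidefinite.isUnit_det_quasiTau (h : Quasidefinite (gram u t)) (n : ℕ) :
    IsUnit (quasiTau u t n).det :=
  h.isUnit_det h.isGaussBorel_gram n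

theorem Quasidefinite.quasiTau_zero (h : Quasidefinite (gram u t)) :
    quasiTau u t 0 = gram u t 0 0 := by
  rw [← h.isGaussBorel_gram.left_self 0]
  simp [h.isGaussBorel_gram.1.1]

theorem polyOne_zero (h : Quasidefinite (gram u t)) (z : ℂ) : polyOne u t 0 z = 1 := by
  simp [polyOne, h.isGaussBorel_gram.1.1]

theorem polyTwo_zero (h : Quasidefinite (gram u t)) (z : ℂ) : polyTwo u t 0 z = 1 := by
  simp [polyTwo, h.isGaussBorel_gram.2.1.1]

theorem tauOne_natCast_sub_one (t s : Times) (n : ℕ) : tauOne u ((n : ℤ) - 1) t s =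
    leftProd (fun m => quasiTau u t m * (quasiTau u s m)⁻¹) n := by
  rw [tauOne, sub_add_cancel, Int.toNat_natCast]

theorem tauTwo_natCast_sub_one (t s : Times) (n : ℕ) : tauTwo u ((n : ℤ) - 1) t s =
    leftProd (fun m => (quasiTau u t m)⁻¹ * quasiTau u s m) n := by
  rw [tauTwo, sub_add_cancel, Int.toNat_natCast]

theorem tauOne_natCast (t s : Times) (n : ℕ) : tauOne u n t s =
    leftProd (fun m => quasiTau u t m * (quasiTau u s m)⁻¹) (n + 1) := rfl

theorem tauTwo_natCast (t s : Times) (n : ℕ) : tauTwo u n t s =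
    leftProd (fun m => (quasiTau u t m)⁻¹ * quasiTau u s m) (n + 1) := rfl

theorem zpow_neg_natCast_sub_one (z : ℂ) (n : ℕ) : z ^ (-(n : ℤ) - 1) = z⁻¹ ^ (n + 1) := by
  rw [← neg_add', zpow_neg, ← Nat.cast_succ, zpow_natCast, inv_pow]

section

variable (hrx : radiusX u < ⊤) (hry : radiusY u < ⊤)
  (ht₁ : (Function.support t.1).Finite) (ht₂ : (Function.support t.2).Finite)
  (hq : Quasidefinite (gram u t)) {z : ℂ} (hz0 : z ≠ 0)
include hrx hry ht₁ ht₂ hq hz0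

theorem polyOne_eq_tauOne (hz : supportX u ⊆ interval z)
    (hq' : Quasidefinite (gram u (t - miwaX z))) (n : ℕ) :
    polyOne u t n z = z ^ n • tauOne u (n - 1) (t - miwaX z) t := by
  rw [tauOne_natCast_sub_one]
  induction n with
  | zero => rw [polyOne_zero hq, pow_zero, one_smul, leftProd]
  | succ n ih =>
    have h := hq.isGaussBorel_gram.eval_succ hq'.isGaussBorel_gram hq hz0
      (gram_sub_miwaX ht₁ ht₂ hrx hry hz) n
    change polyOne u t (n + 1) z = z • (_ * polyOne u t n z) at h
    -- Each Darboux step prepends the factor H'_n H_n⁻¹ and one power of z.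
    rw [h, ih, leftProd, mul_smul_comm, smul_smul, pow_succ']

theorem polyTwo_eq_tauTwo (hz : supportY u ⊆ interval z)
    (hq' : Quasidefinite (gram u (t + miwaY z))) (n : ℕ) :
    (polyTwo u t n z)ᵀ = z ^ n • (tauTwo u (n - 1) (t + miwaY z) t)⁻¹ := by
  rw [tauTwo_natCast_sub_one]
  induction n with
  | zero => simp [polyTwo_zero hq, leftProd]
  | succ n ih =>
    have h := hq.isGaussBorel_gram.transpose.eval_succ hq'.isGaussBorel_gram.transpose hq.transpose
      hz0 (fun k l => by
        simp only [blockTranspose]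
        rw [gram_add_miwaY ht₁ ht₂ hrx hry hz l k, Matrix.transpose_sub, Matrix.transpose_smul]) n
    change polyTwo u t (n + 1) z = z • (_ * polyTwo u t n z) at h
    -- Transposition puts the new factor H_n⁻¹ H'_n on the right, which is where inverting the
    -- ordered product places it.
    rw [h, leftProd, Matrix.mul_inv_rev, Matrix.mul_inv_rev,
      Matrix.nonsing_inv_nonsing_inv _ (hq'.isUnit_det_quasiTau n), Matrix.transpose_smul,
      Matrix.transpose_mul, Matrix.transpose_mul, Matrix.transpose_nonsing_inv,
      Matrix.transpose_transpose, Matrix.transpose_transpose, ih, smul_mul_assoc, smul_smul,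
      pow_succ']

theorem secondKindOne_eq_tauTwo (hz : supportY u ⊆ interval z)
    (hq' : Quasidefinite (gram u (t - miwaY z))) (n : ℕ) :
    (quasiTau u t n)⁻¹ * secondKindOne u t n z =
      z ^ (-(n : ℤ) - 1) • tauTwo u n t (t - miwaY z) := by
  -- The induction concerns ⟨P_n, I⟩ at the shifted times; the Cauchy kernel supplies the remaining
  -- z⁻¹.
  have key : (quasiTau u t n)⁻¹ * ∑ k ∈ Finset.range (n + 1),
      gbS₁ u t n k * gram u (t - miwaY z) k 0 = z⁻¹ ^ n • tauTwo u n t (t - miwaY z) := by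
    rw [tauTwo_natCast]
    induction n with
    | zero =>
      simp [hq.isGaussBorel_gram.1.1, leftProd, hq'.quasiTau_zero]
    | succ n ih =>
      rw [hq.isGaussBorel_gram.first_succ hq'.isGaussBorel_gram hq
        (gram_sub_miwaY ht₁ ht₂ hrx hry hz) n, leftProd, mul_assoc, ih]
      simp only [mul_smul_comm, smul_smul, pow_succ', mul_assoc]
  rw [secondKindOne_eq ht₁ ht₂ hrx hry hz hz0, mul_smul_comm, key, smul_smul,
    zpow_neg_natCast_sub_one, pow_succ']

theorem secondKindTwo_eq_tauOne (hz : supportX u ⊆ interval z)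
    (hq' : Quasidefinite (gram u (t + miwaX z))) (n : ℕ) :
    (secondKindTwo u t n z)ᵀ * (quasiTau u t n)⁻¹ =
      z ^ (-(n : ℤ) - 1) • (tauOne u n t (t + miwaX z))⁻¹ := by
  have key : (∑ l ∈ Finset.range (n + 1), gram u (t + miwaX z) 0 l * (gbS₂ u t n l)ᵀ) *
      (quasiTau u t n)⁻¹ = z⁻¹ ^ n • (tauOne u n t (t + miwaX z))⁻¹ := by
    rw [tauOne_natCast]
    have hinv : ∀ m, (quasiTau u t m * (quasiTau u (t + miwaX z) m)⁻¹)⁻¹ =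
        quasiTau u (t + miwaX z) m * (quasiTau u t m)⁻¹ := fun m => by
      rw [Matrix.mul_inv_rev, Matrix.nonsing_inv_nonsing_inv _ (hq'.isUnit_det_quasiTau m)]
    induction n with
    | zero =>
      simp [hq.isGaussBorel_gram.2.1.1, leftProd, ← hq'.quasiTau_zero, hinv]
    | succ n ih =>
      -- Transposed, the recursion appends H_n⁻¹ H'_{n+1} on the right; with the outer H_{n+1}⁻¹
      -- this completes the inverse of the new leftmost τ-factor.
      have h := hq.isGaussBorel_gram.transpose.first_succ hq'.isGaussBorel_gram.transpose
        hq.transpose (c := z⁻¹) (fun k l => by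
          simp only [blockTranspose]
          rw [gram_add_miwaX ht₁ ht₂ hrx hry hz l k, Matrix.transpose_sub,
            Matrix.transpose_smul]) n
      have h' := congrArg Matrix.transpose h
      simp only [Matrix.transpose_sum, Matrix.transpose_mul, Matrix.transpose_smul, blockTranspose,
        Matrix.transpose_transpose, Matrix.transpose_nonsing_inv] at h'
      rw [h', leftProd, Matrix.mul_inv_rev, hinv, ← mul_assoc, ih]
      simp only [smul_mul_assoc, smul_smul, pow_succ', mul_assoc]
  rw [secondKindTwo_transpose_eq ht₁ ht₂ hrx hry hz hz0, smul_mul_assoc, key, smul_smul,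
    zpow_neg_natCast_sub_one, pow_succ']

end
end flows
end SatoToda
end

theorem mainTheorem10 {p : ℕ} (u : SatoToda.KernelMatrix p)
    (hrx : SatoToda.radiusX u < ⊤) (hry : SatoToda.radiusY u < ⊤)
    (t : SatoToda.Times) (ht₁ : (Function.support t.1).Finite)
    (ht₂ : (Function.support t.2).Finite)
    (hq : SatoToda.Quasidefinite (SatoToda.gram u t)) (n : ℕ) (z : ℂ) :
    (SatoToda.radiusX u < ‖z‖ₑ →
      (SatoToda.Quasidefinite (SatoToda.gram u (t - SatoToda.miwaX z)) →
        SatoToda.polyOne u t n z =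
          z ^ n • SatoToda.tauOne u (n - 1) (t - SatoToda.miwaX z) t) ∧
      (SatoToda.Quasidefinite (SatoToda.gram u (t + SatoToda.miwaX z)) →
        (SatoToda.secondKindTwo u t n z)ᵀ * (SatoToda.quasiTau u t n)⁻¹ =
          z ^ (-(n : ℤ) - 1) • (SatoToda.tauOne u n t (t + SatoToda.miwaX z))⁻¹)) ∧
    (SatoToda.radiusY u < ‖z‖ₑ →
      (SatoToda.Quasidefinite (SatoToda.gram u (t - SatoToda.miwaY z)) →
        (SatoToda.quasiTau u t n)⁻¹ * SatoToda.secondKindOne u t n z =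
          z ^ (-(n : ℤ) - 1) • SatoToda.tauTwo u n t (t - SatoToda.miwaY z)) ∧
      (SatoToda.Quasidefinite (SatoToda.gram u (t + SatoToda.miwaY z)) →
        (SatoToda.polyTwo u t n z)ᵀ =
          z ^ n • (SatoToda.tauTwo u (n - 1) (t + SatoToda.miwaY z) t)⁻¹)) := by
  have h0 : ∀ r : ℝ≥0∞, r < ‖z‖ₑ → z ≠ 0 := fun r hr hz => by
    rw [hz, enorm_zero] at hr
    exact not_lt_zero hr
  refine ⟨fun h => ?_, fun h => ?_⟩
  · have hs := SatoToda.supportX_subset_interval h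
    exact ⟨fun hq' => SatoToda.polyOne_eq_tauOne hrx hry ht₁ ht₂ hq (h0 _ h) hs hq' n,
      fun hq' => SatoToda.secondKindTwo_eq_tauOne hrx hry ht₁ ht₂ hq (h0 _ h) hs hq' n⟩
  · have hs := SatoToda.supportY_subset_interval h
    exact ⟨fun hq' => SatoToda.secondKindOne_eq_tauTwo hrx hry ht₁ ht₂ hq (h0 _ h) hs hq' n,
      fun hq' => SatoToda.polyTwo_eq_tauTwo hrx hry ht₁ ht₂ hq (h0 _ h) hs hq' n⟩
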